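/- Let $G$ be a finite group. (a) Let $V$ be a complex Lie group of dimension $n$ with identity $e$, on which $G$ acts by holomorphic group automorphisms. Let $(\mathcal O_{\mathsf C})_e$ be the algebra of germs at $e$ of holomorphic functions. Then there exist holomorphic coordinates $x_1,\dots,x_n$ in a neighbourhood of $e$, centred at $e$, such that the linear span of the germs of $x_1,\dots,x_n$ at $e$ is $G$-invariant. For any such coordinates, let $(\mathcal O_{\mathsf A})_e\subset(\mathcal O_{\mathsf C})_e$ be the algebra of germs at $e$ of polynomials in $x_1,\dots,x_n$. For $\mathsf X\in\{\mathsf A,\mathsf C\}$ let $(\mathcal J_{\mathsf X})_e$ be the ideal of $(\mathcal O_{\mathsf X})_e$ generated by the $G$-invariant germs in $(\mathcal O_{\mathsf X})_e$ that are equal to $0$ at $e$, where $(g\cdot f)(v)=f(g^{-1}\cdot v)$. Then the natural map $$(\mathcal O_{\mathsf A}/\mathcal J_{\mathsf A})_e\longrightarrow(\mathcal O_{\mathsf C}/\mathcal J_{\mathsf C})_e,\qquad f\mapsto f+(\mathcal J_{\mathsf C})_e,$$ is an isomorphism of algebras. In particular, $(\mathcal O_{\mathsf C}/\mathcal J_{\mathsf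 C})_e$ is a finite-dimensional complex vector space, of dimension at most $|G|^{n}$. (b) Let $V$ be a linear algebraic group over $\mathbb C$ (a Zariski closed subgroup of $GL_m(\mathbb C)$ for some $m$) with identity $e$, on which $G$ acts by algebraic group automorphisms. Let $(\mathcal O_{\mathsf A})_e$ be the stalk at $e$ of the sheaf of regular functions on $V$, that is, the algebra of germs at $e$ (for the Zariski topology) of fractions $p/q$ with $p,q\in\mathbb C[V]$ and $q(e)\neq 0$. Let $(\mathcal O_{\mathsf C})_e$ be the algebra of germs at $e$ of holomorphic functions on $V$, that is, of restrictions to $V$ of functions holomorphic in a neighbourhood of $e$ in the space of $m\times m$ matrices. Define $(\mathcal J_{\mathsf A})_e$ and $(\mathcal J_{\mathsf C})_e$ as in (a). Then the natural map $(\mathcal O_{\mathsf A}/\mathcal J_{\mathsf A})_e\to(\mathcal O_{\mathsf C}/\mathcal J_{\mathsf C})_e$ is an isomorphism of algebras. In particular, $(\mathcal O_{\mathsf C}/\mathcal J_{\mathsf C})_e$ is a finite-dimensional complex vector space, of dimension at most $|G|^{\dim V}$, where $\dim V$ is the (finite) Krull dimension of $\mathbb C[V]$. -/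

import Mathlib

open Filter Topology
open scoped Manifold ContDiff

noncomputable section

namespace Coinvariants

/-! ### Germs of complex-valued functions along a filter -/

section Germs

variable {X : Type*}

/-- Germs of complex-valued functions form a `ℂ`-algebra (pointwise operations). -/
instance germAlgebra (l : Filter X) : Algebra ℂ (Germ l ℂ) :=
  Algebra.ofModule
    (fun r x y => Germ.inductionOn₂ x y fun f g =>
      congrArg (fun h : X → ℂ => (h : Germ l ℂ)) (smul_mul_assoc r f g))
    (fun r x y => Germ.inductionOn₂ x y fun f g =>
      congrArg (fun h : X → ℂ => (h : Germ l ℂ)) (mul_smul_comm r f g))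

theorem algebraMap_germ (l : Filter X) (r : ℂ) :
    algebraMap ℂ (Germ l ℂ) r = ((fun _ => r : X → ℂ) : Germ l ℂ) := by
  rw [Algebra.algebraMap_eq_smul_one]
  change ((r • (1 : X → ℂ) : X → ℂ) : Germ l ℂ) = _
  congr 1
  funext x
  simp

/-- Restriction of germs to a finer filter: the germ of `F` along `l` goes to the germ of `F`
along `l'`. -/
def germRestrict {l l' : Filter X} (h : l' ≤ l) : Germ l ℂ →ₐ[ℂ] Germ l' ℂ where
  toFun f := Germ.compTendsto f id h
  map_one' := rfl
  map_mul' x y := Germ.inductionOn₂ x y fun _ _ => rfl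
  map_zero' := rfl
  map_add' x y := Germ.inductionOn₂ x y fun _ _ => rfl
  commutes' r := by simp only [algebraMap_germ]; rfl

theorem germRestrict_coe {l l' : Filter X} (h : l' ≤ l) (F : X → ℂ) :
    germRestrict h (F : Germ l ℂ) = (F : Germ l' ℂ) := rfl

end Germs

/-! ### Coinvariants of an algebra of germs at the identity -/

section Coinvariants

variable (G : Type*) [Group G] {V : Type*} [Group V] [MulDistribMulAction G V]

/-- A germ along `l` is `G`-invariant if it is the germ of a function `F` such that
`g · F = F ∘ g⁻¹` and `F` have the same germ, for every `g`. -/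
def IsInvariantGerm {l : Filter V} (f : Germ l ℂ) : Prop :=
  ∃ F : V → ℂ, (F : Germ l ℂ) = f ∧ ∀ g : G, (fun v => F (g⁻¹ • v)) =ᶠ[l] F

/-- A germ (at the identity) is equal to `0` at the identity. -/
def VanishesAtOne {l : Filter V} (f : Germ l ℂ) : Prop :=
  ∃ F : V → ℂ, (F : Germ l ℂ) = f ∧ F 1 = 0

/-- The ideal `𝒥` of an algebra `𝒪` of germs at the identity generated by the `G`-invariant
germs in `𝒪` that are equal to `0` at the identity. -/
def coinvariantIdeal {l : Filter V} (O : Subalgebra ℂ (Germ l ℂ)) : Ideal O :=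
  Ideal.span {f : O | IsInvariantGerm G (f : Germ l ℂ) ∧ VanishesAtOne (f : Germ l ℂ)}

/-- The coinvariant space `𝒪 / 𝒥`. -/
abbrev CoinvariantSpace {l : Filter V} (O : Subalgebra ℂ (Germ l ℂ)) : Type _ :=
  O ⧸ coinvariantIdeal G O

/-- Restriction of germs, as a homomorphism between two algebras of germs. -/
def restrictHom {l l' : Filter V} (h : l' ≤ l) (A : Subalgebra ℂ (Germ l ℂ))
    (C : Subalgebra ℂ (Germ l' ℂ)) (hAC : A ≤ C.comap (germRestrict h)) : A →ₐ[ℂ] C :=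
  ((germRestrict h).comp A.val).codRestrict C fun f => hAC f.2

theorem coinvariantIdeal_le_comap {l l' : Filter V} (h : l' ≤ l) (A : Subalgebra ℂ (Germ l ℂ))
    (C : Subalgebra ℂ (Germ l' ℂ)) (hAC : A ≤ C.comap (germRestrict h)) :
    coinvariantIdeal G A ≤ (coinvariantIdeal G C).comap (restrictHom h A C hAC) := by
  refine Ideal.span_le.2 ?_
  rintro ⟨f, hf⟩ ⟨⟨F, hF, hFG⟩, ⟨F', hF', hF'0⟩⟩
  dsimp only at hF hF'
  refine Ideal.subset_span ⟨⟨F, ?_, fun g => (hFG g).filter_mono h⟩, ⟨F', ?_, hF'0⟩⟩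
  · change _ = germRestrict h f
    rw [← hF, germRestrict_coe]
  · change _ = germRestrict h f
    rw [← hF', germRestrict_coe]

/-- The natural map `𝒪_A / 𝒥_A → 𝒪_C / 𝒥_C`, `f ↦ f + 𝒥_C`. -/
def coinvariantMap {l l' : Filter V} (h : l' ≤ l) (A : Subalgebra ℂ (Germ l ℂ))
    (C : Subalgebra ℂ (Germ l' ℂ)) (hAC : A ≤ C.comap (germRestrict h)) :
    CoinvariantSpace G A →ₐ[ℂ] CoinvariantSpace G C :=
  Ideal.quotientMapₐ (coinvariantIdeal G C) (restrictHom h A C hAC)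
    (coinvariantIdeal_le_comap G h A C hAC)

end Coinvariants

/-! ### Complex Lie groups -/

section Analytic

variable (n : ℕ) (V : Type*) [TopologicalSpace V] [ChartedSpace (Fin n → ℂ) V] [Group V]

/-- The algebra `(𝒪_C)_e` of germs at the identity of functions that are holomorphic in a
neighbourhood of the identity. -/
def holGerms : Subalgebra ℂ (Germ (𝓝 (1 : V)) ℂ) where
  carrier := {f | ∃ F : V → ℂ, (F : Germ (𝓝 (1 : V)) ℂ) = f ∧
    ∀ᶠ v in 𝓝 (1 : V), ContMDiffAt 𝓘(ℂ, Fin n → ℂ) 𝓘(ℂ) ω F v}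
  mul_mem' := by
    rintro _ _ ⟨F, rfl, hF⟩ ⟨F', rfl, hF'⟩
    exact ⟨F * F', rfl, by filter_upwards [hF, hF'] with v h h' using h.mul h'⟩
  add_mem' := by
    rintro _ _ ⟨F, rfl, hF⟩ ⟨F', rfl, hF'⟩
    exact ⟨F + F', rfl, by filter_upwards [hF, hF'] with v h h' using h.add h'⟩
  algebraMap_mem' r :=
    ⟨fun _ => r, (algebraMap_germ _ r).symm, Eventually.of_forall fun _ => contMDiffAt_const⟩

variable {n V}

/-- The germ at the identity of the `i`-th coordinate function of a chart. -/
def coordGerm (x : OpenPartialHomeomorph V (Fin n → ℂ)) (i : Fin n) : Germ (𝓝 (1 : V)) ℂ :=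
  ((fun v => x v i : V → ℂ) : Germ (𝓝 (1 : V)) ℂ)

/-- Holomorphic coordinates `x = (x₁, …, xₙ)` in a neighbourhood of the identity, centred at the
identity, such that the linear span of (the germs of) `x₁, …, xₙ` is `G`-invariant. -/
structure IsLinearizingChart (G : Type*) [Group G] [MulDistribMulAction G V]
    (x : OpenPartialHomeomorph V (Fin n → ℂ)) : Prop where
  mem_maximalAtlas : x ∈ IsManifold.maximalAtlas 𝓘(ℂ, Fin n → ℂ) ω V
  one_mem_source : (1 : V) ∈ x.source
  map_one : x 1 = 0
  span_invariant : ∀ (g : G) (i : Fin n),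
    ((fun v => x (g⁻¹ • v) i : V → ℂ) : Germ (𝓝 (1 : V)) ℂ) ∈
      Submodule.span ℂ (Set.range (coordGerm x))

/-- The algebra `(𝒪_A)_e` of germs at the identity of polynomials in the coordinates
`x₁, …, xₙ`. -/
def polyGerms (x : OpenPartialHomeomorph V (Fin n → ℂ)) : Subalgebra ℂ (Germ (𝓝 (1 : V)) ℂ) :=
  Algebra.adjoin ℂ (Set.range (coordGerm x))

theorem polyGerms_le_holGerms {G : Type*} [Group G] [MulDistribMulAction G V]
    {x : OpenPartialHomeomorph V (Fin n → ℂ)} (hx : IsLinearizingChart G x) :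
    polyGerms x ≤ (holGerms n V).comap (germRestrict le_rfl) := by
  refine Algebra.adjoin_le ?_
  rintro _ ⟨i, rfl⟩
  refine ⟨fun v => x v i, rfl, ?_⟩
  filter_upwards [x.open_source.mem_nhds hx.one_mem_source] with v hv
  exact contMDiffAt_pi_space.1 (contMDiffAt_of_mem_maximalAtlas hx.mem_maximalAtlas hv) i

end Analytic

/-! ### Linear algebraic groups -/

section Algebraic

variable {m : ℕ} (V : Subgroup (GL (Fin m) ℂ))

/-- `V` is a linear algebraic group: a subgroup of `GL_m(ℂ)` cut out in `GL_m(ℂ)` by polynomial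
equations in the matrix entries. -/
def IsLinearAlgebraicGroup : Prop :=
  ∃ S : Set (MvPolynomial (Fin m × Fin m) ℂ), ∀ a : GL (Fin m) ℂ,
    a ∈ V ↔ ∀ p ∈ S, MvPolynomial.eval (fun ij => (a : Matrix (Fin m) (Fin m) ℂ) ij.1 ij.2) p = 0

variable {V} in
/-- The matrix entries of an element of `V`. -/
def entries (v : V) : Fin m → Fin m → ℂ :=
  fun i j => ((v : GL (Fin m) ℂ) : Matrix (Fin m) (Fin m) ℂ) i j

/-- The algebra `ℂ[V]` of regular functions on `V`: polynomials in the matrix entries and the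
inverse of the determinant. -/
def regularFunctions : Subalgebra ℂ (V → ℂ) :=
  Algebra.adjoin ℂ ({f | ∃ i j, f = fun v => entries v i j} ∪
    {fun v : V => (((v : GL (Fin m) ℂ) : Matrix (Fin m) (Fin m) ℂ).det)⁻¹})

/-- The Zariski topology on `V`, with the principal open sets as a basis. -/
abbrev zariskiTopology : TopologicalSpace V :=
  TopologicalSpace.generateFrom {U | ∃ q ∈ regularFunctions V, U = {v | q v ≠ 0}}

/-- The filter of Zariski neighbourhoods of the identity. -/
def zariskiNhds : Filter V := @nhds V (zariskiTopology V) 1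

variable {V} in
theorem continuous_of_mem_regularFunctions {f : V → ℂ} (hf : f ∈ regularFunctions V) :
    Continuous f := by
  have hval : Continuous fun v : V => ((v : GL (Fin m) ℂ) : Matrix (Fin m) (Fin m) ℂ) :=
    Units.continuous_val.comp continuous_subtype_val
  refine Algebra.adjoin_induction (p := fun f _ => Continuous f) ?_ ?_ ?_ ?_ hf
  · rintro f (⟨i, j, rfl⟩ | rfl)
    · exact hval.matrix_elem i j
    · refine hval.matrix_det.inv₀ fun v => ?_
      exact ((Matrix.isUnit_iff_isUnit_det _).1 (v : GL (Fin m) ℂ).isUnit).ne_zero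
  · intro r
    exact continuous_const
  · intro f g _ _ hf hg
    exact hf.add hg
  · intro f g _ _ hf hg
    exact hf.mul hg

theorem nhds_le_zariskiNhds : 𝓝 (1 : V) ≤ zariskiNhds V := by
  refine nhds_mono (le_generateFrom ?_)
  rintro _ ⟨q, hq, rfl⟩
  exact isOpen_ne_fun (continuous_of_mem_regularFunctions hq) continuous_const

/-- The algebra `(𝒪_A)_e`: the stalk at the identity of the sheaf of regular functions on `V`,
that is, the algebra of germs (for the Zariski topology) of fractions `p / q` of regular
functions with `q(e) ≠ 0`. -/
def regGerms : Subalgebra ℂ (Germ (zariskiNhds V) ℂ) where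
  carrier := {f | ∃ p ∈ regularFunctions V, ∃ q ∈ regularFunctions V, q 1 ≠ 0 ∧
    ((fun v => p v / q v : V → ℂ) : Germ (zariskiNhds V) ℂ) = f}
  mul_mem' := by
    rintro _ _ ⟨p, hp, q, hq, h1, rfl⟩ ⟨p', hp', q', hq', h1', rfl⟩
    refine ⟨p * p', mul_mem hp hp', q * q', mul_mem hq hq', mul_ne_zero h1 h1', ?_⟩
    rw [← Germ.coe_mul]
    congr 1
    funext v
    simp [div_mul_div_comm]
  add_mem' := by
    rintro _ _ ⟨p, hp, q, hq, h1, rfl⟩ ⟨p', hp', q', hq', h1', rfl⟩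
    refine ⟨p * q' + q * p', add_mem (mul_mem hp hq') (mul_mem hq hp'), q * q', mul_mem hq hq',
      mul_ne_zero h1 h1', ?_⟩
    have key : ∀ q ∈ regularFunctions V, q 1 ≠ 0 → ∀ᶠ v in zariskiNhds V, q v ≠ 0 := by
      intro q hq h1
      have hU : IsOpen[zariskiTopology V] {v | q v ≠ 0} :=
        TopologicalSpace.isOpen_generateFrom_of_mem ⟨q, hq, rfl⟩
      exact (@mem_nhds_iff V (zariskiTopology V) 1 _).2 ⟨_, subset_rfl, hU, h1⟩
    rw [← Germ.coe_add]
    refine Germ.coe_eq.2 ?_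
    filter_upwards [key q hq h1, key q' hq' h1'] with v h h'
    simp [div_add_div _ _ h h']
  algebraMap_mem' r := by
    refine ⟨algebraMap ℂ _ r, algebraMap_mem _ r, 1, one_mem _, one_ne_zero, ?_⟩
    rw [algebraMap_germ]
    congr 1
    funext v
    simp

/-- The algebra `(𝒪_C)_e` of germs at the identity of holomorphic functions on the closed complex
submanifold `V` of `GL_m(ℂ)`: germs (for the classical topology) of restrictions to `V` of
functions of the matrix entries that are holomorphic near the identity matrix. -/
def holGermsLinear : Subalgebra ℂ (Germ (𝓝 (1 : V)) ℂ) where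
  carrier := {f | ∃ F : (Fin m → Fin m → ℂ) → ℂ, AnalyticAt ℂ F (entries (1 : V)) ∧
    ((fun v => F (entries v) : V → ℂ) : Germ (𝓝 (1 : V)) ℂ) = f}
  mul_mem' := by
    rintro _ _ ⟨F, hF, rfl⟩ ⟨F', hF', rfl⟩
    exact ⟨F * F', hF.mul hF', rfl⟩
  add_mem' := by
    rintro _ _ ⟨F, hF, rfl⟩ ⟨F', hF', rfl⟩
    exact ⟨F + F', hF.add hF', rfl⟩
  algebraMap_mem' r := ⟨fun _ => r, analyticAt_const, (algebraMap_germ _ r).symm⟩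

theorem regularFunctions_germ_mem {f : V → ℂ} (hf : f ∈ regularFunctions V) :
    ∃ F : (Fin m → Fin m → ℂ) → ℂ, AnalyticAt ℂ F (entries (1 : V)) ∧
      ∀ v : V, F (entries v) = f v := by
  have hcoord : ∀ i j, AnalyticAt ℂ (fun a : Fin m → Fin m → ℂ => a i j) (entries (1 : V)) :=
    fun i j => ((ContinuousLinearMap.proj (R := ℂ) (φ := fun _ : Fin m => ℂ) j).comp
      (ContinuousLinearMap.proj (R := ℂ) (φ := fun _ : Fin m => Fin m → ℂ) i)).analyticAt _
  refine Algebra.adjoin_induction (p := fun f _ => ∃ F : (Fin m → Fin m → ℂ) → ℂ,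
    AnalyticAt ℂ F (entries (1 : V)) ∧ ∀ v : V, F (entries v) = f v) ?_ ?_ ?_ ?_ hf
  · rintro f (⟨i, j, rfl⟩ | rfl)
    · exact ⟨fun a => a i j, hcoord i j, fun v => rfl⟩
    · refine ⟨fun a => (Matrix.det (Matrix.of a))⁻¹, ?_, fun v => rfl⟩
      refine AnalyticAt.inv ?_ ?_
      · simp only [Matrix.det_apply']
        refine Finset.analyticAt_fun_sum _ fun σ _ => analyticAt_const.mul ?_
        exact Finset.analyticAt_fun_prod _ fun i _ => hcoord _ _
      · exact ((Matrix.isUnit_iff_isUnit_det _).1 ((1 : V) : GL (Fin m) ℂ).isUnit).ne_zero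
  · intro r
    exact ⟨fun _ => r, analyticAt_const, fun _ => rfl⟩
  · rintro f g _ _ ⟨F, hF, hFf⟩ ⟨F', hF', hFg⟩
    exact ⟨F + F', hF.add hF', fun v => by simp [hFf, hFg]⟩
  · rintro f g _ _ ⟨F, hF, hFf⟩ ⟨F', hF', hFg⟩
    exact ⟨F * F', hF.mul hF', fun v => by simp [hFf, hFg]⟩

theorem regGerms_le_holGermsLinear :
    regGerms V ≤ (holGermsLinear V).comap (germRestrict (nhds_le_zariskiNhds V)) := by
  rintro _ ⟨p, hp, q, hq, h1, rfl⟩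
  obtain ⟨P, hP, hPp⟩ := regularFunctions_germ_mem V hp
  obtain ⟨Q, hQ, hQq⟩ := regularFunctions_germ_mem V hq
  refine ⟨fun a => P a / Q a, hP.div hQ (by rwa [hQq]), ?_⟩
  simp only [hPp, hQq]
  rfl

end Algebraic

end Coinvariants

end

/-! Both parts are instances of one algebraic comparison. Let `φ : A → C` be an equivariant map of
augmented algebras with augmentation ideals `m_A`, `m_C` and invariant-generated ideals `J_A`,
`J_C`. Every `a ∈ m_A` is a root of `∏ (X - g • a)`, whose lower coefficients are invariants in
`m_A`; hence `a ^ |G| ∈ J_A`, and `m_A ^ k ≤ J_A` for some `k` because `m_A` is finitely generated.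
Thus only finite-order information matters. If `φ(m_A)` generates `m_C`, then `φ(A)` is dense in `C`
for the `m_C`-adic topology, which gives surjectivity. For injectivity, invariants of `C` are
approximated by invariants of `A` (Reynolds operator), and one needs that a polynomial in the chosen
generators `x₁, …, x_t` of `m_A` modulo `m_A ^ 2` whose image lies in `m_C ^ k` has no term of
degree below `k`. The monomials in the `x_i` with all exponents below `|G|` span `A / J_A`, whence
the bound `|G| ^ t`. This is `bijective_quotientMap_augCoinvariantIdeal` and
`finrank_quotient_augCoinvariantIdeal_le`.

The condition on polynomials is checked analytically: pulled back along a parametrization `E` with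
`x_i (E u) = u_i`, elements of `m_C ^ k` are `O(‖u‖ ^ k)`. That `φ(m_A)` generates `m_C` is a
Hadamard-type division of analytic functions.

For a complex Lie group, averaging a chart over `G` linearizes the action, and `E` is the inverse
chart. For a linear algebraic group, `E` is the exponential of the Lie algebra, corrected by a local
inverse. Linear forms that kill the Lie algebra are differentials of equations of `V`, so they give
germs in `m_A ^ 2`; hence `t = dim Lie V` functions generate `m_A` modulo `m_A ^ 2`. They are
algebraically independent, so `t` is at most the Krull dimension. -/

noncomputable section

namespace Coinvariants

/-! ### Augmented algebras with a finite group action -/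

section Augmented

variable {R : Type*} [CommRing R]

/-- In the expansion of `(⟨s⟩ ^ k + I ^ (k + 1)) (⟨s⟩ + I ^ 2)` every term except `⟨s⟩ ^ (k + 1)`
lies in `I ^ (k + 2)`. -/
theorem pow_le_span_pow_sup {I : Ideal R} {s : Set R} (hs : s ⊆ I)
    (h : I ≤ Ideal.span s ⊔ I ^ 2) (k : ℕ) : I ^ k ≤ Ideal.span s ^ k ⊔ I ^ (k + 1) := by
  have hsI : Ideal.span s ≤ I := Ideal.span_le.2 hs
  induction k with
  | zero => simp
  | succ k ih =>
    calc I ^ (k + 1) = I ^ k * I := pow_succ _ _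
      _ ≤ (Ideal.span s ^ k ⊔ I ^ (k + 1)) * (Ideal.span s ⊔ I ^ 2) := Ideal.mul_mono ih h
      _ ≤ Ideal.span s ^ (k + 1) ⊔ I ^ (k + 1 + 1) := by
        rw [Ideal.sup_mul, Ideal.mul_sup, Ideal.mul_sup]
        have h1 : Ideal.span s ^ k * I ^ 2 ≤ I ^ (k + 1 + 1) :=
          (Ideal.mul_mono_left (Ideal.pow_right_mono hsI k)).trans_eq (by ring)
        have h2 : I ^ (k + 1) * Ideal.span s ≤ I ^ (k + 1 + 1) :=
          (Ideal.mul_mono_right hsI).trans_eq (by ring)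
        have h3 : I ^ (k + 1) * I ^ 2 ≤ I ^ (k + 1 + 1) := by
          rw [← pow_add]; exact Ideal.pow_le_pow_right (by omega)
        rw [← pow_succ]
        exact sup_le (sup_le le_sup_left (h1.trans le_sup_right))
          (sup_le (h2.trans le_sup_right) (h3.trans le_sup_right))

variable [Algebra ℂ R]

/-- The augmentation ideal of an augmented `ℂ`-algebra. -/
abbrev augIdeal (ε : R →ₐ[ℂ] ℂ) : Ideal R := RingHom.ker ε

theorem sub_algebraMap_mem_augIdeal (ε : R →ₐ[ℂ] ℂ) (a : R) :
    a - algebraMap ℂ R (ε a) ∈ augIdeal ε := by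
  simp [RingHom.mem_ker]

open scoped Pointwise in
/-- If a subalgebra contains generators of the augmentation ideal modulo its square, it is dense
in the adic topology. -/
theorem exists_mem_sub_mem_pow (ε : R →ₐ[ℂ] ℂ) (B : Subalgebra ℂ R) {s : Set R}
    (hsB : s ⊆ B) (hsI : s ⊆ augIdeal ε) (h : augIdeal ε ≤ Ideal.span s ⊔ augIdeal ε ^ 2)
    (k : ℕ) (f : R) : ∃ b ∈ B, f - b ∈ augIdeal ε ^ k := by
  have hsB' : ∀ k : ℕ, s ^ k ⊆ (B : Set R) := by
    intro k
    induction k with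
    | zero => simp
    | succ k ih =>
      rw [pow_succ]
      rintro _ ⟨a, ha, b, hb, rfl⟩
      exact mul_mem (ih ha) (hsB hb)
  have step : ∀ k, ∀ f ∈ Ideal.span s ^ k, ∃ b ∈ B, f - b ∈ augIdeal ε ^ (k + 1) := by
    intro k f hf
    rw [Ideal.span, Submodule.span_pow] at hf
    induction hf using Submodule.span_induction with
    | zero => exact ⟨0, zero_mem _, by simp⟩
    | mem m hm => exact ⟨m, hsB' k hm, by simp⟩
    | add a b _ _ ha hb =>
      obtain ⟨a', ha', ha⟩ := ha
      obtain ⟨b', hb', hb⟩ := hb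
      exact ⟨a' + b', add_mem ha' hb', by simpa [add_sub_add_comm] using add_mem ha hb⟩
    | smul a m hmk hm =>
      obtain ⟨m', hm', hm⟩ := hm
      -- The coefficient `a` may lie outside `B`, so it is replaced by its constant term; the error
      -- `a - ε a` lies in the augmentation ideal and gains one order.
      refine ⟨ε a • m', B.smul_mem hm' _, ?_⟩
      have h1 : a • m - ε a • m' = (a - algebraMap ℂ R (ε a)) * m' + a * (m - m') := by
        rw [smul_eq_mul, Algebra.smul_def]; ring
      have h2 : m' ∈ augIdeal ε ^ k := by
        have h3 : m ∈ augIdeal ε ^ k := by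
          rw [← Submodule.span_pow] at hmk
          exact Ideal.pow_right_mono (Ideal.span_le.2 hsI) k hmk
        have := sub_mem h3 (Ideal.pow_le_pow_right (Nat.le_succ k) hm)
        simpa using this
      rw [h1]
      refine add_mem ?_ (Ideal.mul_mem_left _ _ hm)
      rw [pow_succ']
      exact Ideal.mul_mem_mul (sub_algebraMap_mem_augIdeal ε a) h2
  induction k with
  | zero => exact ⟨0, zero_mem _, by simp⟩
  | succ k ih =>
    obtain ⟨b, hb, hfb⟩ := ih
    obtain ⟨u, hu, v, hv, huv⟩ := Submodule.mem_sup.1 (pow_le_span_pow_sup hsI h k hfb)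
    obtain ⟨c, hc, huc⟩ := step k u hu
    refine ⟨b + c, add_mem hb hc, ?_⟩
    have : f - (b + c) = (u - c) + v := by rw [← sub_sub, ← huv]; ring
    rw [this]
    exact add_mem huc hv

variable (G : Type*) [Group G] [MulSemiringAction G R]

/-- The ideal generated by the invariants in the augmentation ideal. -/
def augCoinvariantIdeal (ε : R →ₐ[ℂ] ℂ) : Ideal R :=
  Ideal.span {f : R | (∀ g : G, g • f = f) ∧ ε f = 0}

variable {G}

theorem smul_mem_augIdeal_pow {ε : R →ₐ[ℂ] ℂ} (hε : ∀ (g : G) a, ε (g • a) = ε a) (k : ℕ) (g : G)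
    {a : R} (ha : a ∈ augIdeal ε ^ k) : g • a ∈ augIdeal ε ^ k := by
  have h : augIdeal ε ≤ (augIdeal ε).comap (MulSemiringAction.toRingHom G R g) := fun b hb => by
    simpa [RingHom.mem_ker, hε] using hb
  exact (Ideal.pow_right_mono h k).trans (Ideal.le_comap_pow _ k) ha

variable (G)

variable [Finite G]

/-- The element `a` is a root of `∏ (X - g • a)`. Its coefficients are invariant, and `ε` maps it to
`X ^ |G|`, so all coefficients but the leading one lie in the ideal. -/
theorem pow_card_mem_augCoinvariantIdeal {ε : R →ₐ[ℂ] ℂ} (hε : ∀ (g : G) a, ε (g • a) = ε a)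
    {a : R} (ha : ε a = 0) : a ^ Nat.card G ∈ augCoinvariantIdeal G ε := by
  classical
  have := Fintype.ofFinite G
  set p := MulSemiringAction.charpoly G a
  have hdeg : p.natDegree = Nat.card G := by
    have := (ε : R →+* ℂ).domain_nontrivial
    simp [p, MulSemiringAction.charpoly_eq, Polynomial.natDegree_prod_of_monic,
      Polynomial.monic_X_sub_C]
  have hmap : p.map (ε : R →+* ℂ) = Polynomial.X ^ Nat.card G := by
    simp [p, MulSemiringAction.charpoly_eq, Polynomial.map_prod, hε, ha]
  have hcoeff : ∀ j < Nat.card G, p.coeff j ∈ augCoinvariantIdeal G ε := fun j hj =>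
    Ideal.subset_span ⟨MulSemiringAction.smul_coeff_charpoly a j, by
      have := congrArg (fun q => Polynomial.coeff q j) hmap
      rw [Polynomial.coeff_map, Polynomial.coeff_X_pow, if_neg hj.ne] at this
      exact this⟩
  have heval := MulSemiringAction.eval_charpoly (G := G) a
  have hmonic := MulSemiringAction.monic_charpoly (G := G) a
  rw [Polynomial.eval_eq_sum_range, Finset.sum_range_succ, Polynomial.coeff_natDegree,
    hmonic.leadingCoeff, one_mul] at heval
  change _ + a ^ p.natDegree = 0 at heval
  rw [hdeg, add_comm, ← eq_neg_iff_add_eq_zero] at heval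
  rw [heval]
  exact neg_mem (sum_mem fun j hj => Ideal.mul_mem_right _ _
    (hcoeff j (Finset.mem_range.1 (hdeg ▸ hj))))

theorem exists_pow_le_augCoinvariantIdeal {ε : R →ₐ[ℂ] ℂ} (hε : ∀ (g : G) a, ε (g • a) = ε a)
    (hfg : (augIdeal ε).FG) : ∃ k, augIdeal ε ^ k ≤ augCoinvariantIdeal G ε :=
  Ideal.exists_pow_le_of_le_radical_of_fg
    (fun _ ha => ⟨_, pow_card_mem_augCoinvariantIdeal G hε ha⟩) hfg


/-- The Reynolds operator. -/
def reynolds (a : R) : R :=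
  (Nat.card G : ℂ)⁻¹ • ∑ᶠ g : G, g • a

theorem smul_reynolds [SMulCommClass G ℂ R] (g : G) (a : R) :
    g • reynolds G a = reynolds G a := by
  have := Fintype.ofFinite G
  simp only [reynolds, finsum_eq_sum_of_fintype]
  rw [smul_comm, Finset.smul_sum]
  congr 1
  exact Fintype.sum_equiv (Equiv.mulLeft g) _ _ fun h => by simp [mul_smul]

theorem reynolds_sub (a b : R) : reynolds G (a - b) = reynolds G a - reynolds G b := by
  have := Fintype.ofFinite G
  simp [reynolds, finsum_eq_sum_of_fintype, smul_sub]

theorem reynolds_of_invariant {a : R} (ha : ∀ g : G, g • a = a) : reynolds G a = a := by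
  have := Fintype.ofFinite G
  simp [reynolds, finsum_eq_sum_of_fintype, ha, ← Nat.cast_smul_eq_nsmul ℂ, smul_smul]

theorem reynolds_mem_augIdeal_pow {ε : R →ₐ[ℂ] ℂ} (hε : ∀ (g : G) a, ε (g • a) = ε a) (k : ℕ)
    {a : R} (ha : a ∈ augIdeal ε ^ k) : reynolds G a ∈ augIdeal ε ^ k := by
  have := Fintype.ofFinite G
  rw [reynolds, finsum_eq_sum_of_fintype, Algebra.smul_def]
  exact Ideal.mul_mem_left _ _ (sum_mem fun g _ => smul_mem_augIdeal_pow hε k g ha)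

theorem map_reynolds {S : Type*} [CommRing S] [Algebra ℂ S] [MulSemiringAction G S]
    (φ : R →ₐ[ℂ] S) (hφ : ∀ (g : G) a, φ (g • a) = g • φ a) (a : R) :
    φ (reynolds G a) = reynolds G (φ a) := by
  have := Fintype.ofFinite G
  simp [reynolds, finsum_eq_sum_of_fintype, hφ]

end Augmented

/-! ### Comparison of coinvariants of two augmented algebras -/

section Comparison

variable {A C : Type*} [CommRing A] [Algebra ℂ A] [CommRing C] [Algebra ℂ C]
  (G : Type*) [Group G] [Finite G] [MulSemiringAction G A] [MulSemiringAction G C]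
  {εA : A →ₐ[ℂ] ℂ} {εC : C →ₐ[ℂ] ℂ}
  {φ : A →ₐ[ℂ] C} {t : ℕ} {x : Fin t → A}

/-- Since the ideal contains a power of `augIdeal εA`, every class is represented by a polynomial in
the `x i`. A monomial with some exponent at least `|G|` vanishes in the quotient, which leaves `|G|
^ t` spanning monomials. -/
theorem finrank_quotient_augCoinvariantIdeal_le (hA : ∀ (g : G) a, εA (g • a) = εA a)
    (hx : ∀ i, εA (x i) = 0) (hfg : (augIdeal εA).FG)
    (hgen : augIdeal εA ≤ Ideal.span (Set.range x) ⊔ augIdeal εA ^ 2) :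
    Module.Finite ℂ (A ⧸ augCoinvariantIdeal G εA) ∧
      Module.finrank ℂ (A ⧸ augCoinvariantIdeal G εA) ≤ Nat.card G ^ t := by
  obtain ⟨k, hk⟩ := exists_pow_le_augCoinvariantIdeal G hA hfg
  set J := augCoinvariantIdeal G εA
  let b : (Fin t → Fin (Nat.card G)) → A ⧸ J := fun e => ∏ i, Ideal.Quotient.mk J (x i) ^ (e i : ℕ)
  have hspan : Submodule.span ℂ (Set.range b) = ⊤ := by
    refine eq_top_iff.2 fun f _ => ?_
    obtain ⟨f, rfl⟩ := Ideal.Quotient.mk_surjective f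
    obtain ⟨p, hp, hfp⟩ := exists_mem_sub_mem_pow εA (Algebra.adjoin ℂ (Set.range x))
      Algebra.subset_adjoin (by rintro _ ⟨i, rfl⟩; exact hx i) hgen k f
    rw [Ideal.Quotient.mk_eq_mk_iff_sub_mem _ _ |>.2 (hk hfp)]
    rw [Algebra.adjoin_range_eq_range_aeval] at hp
    obtain ⟨P, rfl⟩ := hp
    clear hfp
    change Ideal.Quotient.mk J (MvPolynomial.aeval x P) ∈ _
    induction P using MvPolynomial.induction_on' with
    | add p q hp hq =>
      rw [map_add, map_add]
      exact add_mem hp hq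
    | monomial u a =>
      have h1 : Ideal.Quotient.mk J (MvPolynomial.aeval x (MvPolynomial.monomial u a)) =
          a • ∏ i, Ideal.Quotient.mk J (x i) ^ u i := by
        rw [MvPolynomial.aeval_monomial, Finsupp.prod_fintype _ _ (by simp), ← Algebra.smul_def]
        change Ideal.Quotient.mkₐ ℂ J _ = _
        rw [map_smul, map_prod]
        simp
      rw [h1]
      refine Submodule.smul_mem _ _ ?_
      by_cases hu : ∀ i, u i < Nat.card G
      · exact Submodule.subset_span ⟨fun i => ⟨u i, hu i⟩, rfl⟩
      · push Not at hu
        obtain ⟨i, hi⟩ := hu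
        rw [Finset.prod_eq_zero (Finset.mem_univ i)]
        · exact zero_mem _
        · rw [← map_pow, Ideal.Quotient.eq_zero_iff_mem]
          exact Ideal.pow_mem_of_pow_mem _ (pow_card_mem_augCoinvariantIdeal G hA (hx i)) hi
  refine ⟨⟨⟨(Set.finite_range b).toFinset, by simpa using hspan⟩⟩, ?_⟩
  have := finrank_range_le_card (R := ℂ) b
  rw [Set.finrank, hspan, finrank_top] at this
  simpa using this

variable [SMulCommClass G ℂ A]

/-- Everything is done modulo a high power of the augmentation ideals, which the coinvariant ideals
absorb. The hypothesis `hpoly` replaces injectivity of the map on associated graded rings: it lets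
the order of vanishing be read off in `C` and brought back to `A`. -/
theorem bijective_quotientMap_augCoinvariantIdeal
    (hA : ∀ (g : G) a, εA (g • a) = εA a) (hC : ∀ (g : G) a, εC (g • a) = εC a)
    (hφ : ∀ (g : G) a, φ (g • a) = g • φ a) (hε : ∀ a, εC (φ a) = εA a)
    (hx : ∀ i, εA (x i) = 0) (hfg : (augIdeal εA).FG)
    (hgen : augIdeal εA ≤ Ideal.span (Set.range x) ⊔ augIdeal εA ^ 2)
    (hmap : augIdeal εC ≤ (augIdeal εA).map φ)
    (hpoly : ∀ (k : ℕ) (P : MvPolynomial (Fin t) ℂ), φ (MvPolynomial.aeval x P) ∈ augIdeal εC ^ k →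
      P ∈ MvPolynomial.idealOfVars (Fin t) ℂ ^ k)
    (hJ : augCoinvariantIdeal G εA ≤ (augCoinvariantIdeal G εC).comap φ) :
    Function.Bijective (Ideal.quotientMapₐ (augCoinvariantIdeal G εC) φ hJ) := by
  obtain ⟨k, hk⟩ := exists_pow_le_augCoinvariantIdeal G hA hfg
  have hφI : (augIdeal εA).map φ ≤ augIdeal εC :=
    Ideal.map_le_iff_le_comap.2 fun a ha => by simpa [RingHom.mem_ker, hε] using ha
  have hφpow : ∀ k, ∀ a ∈ augIdeal εA ^ k, φ a ∈ augIdeal εC ^ k := fun k a ha =>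
    Ideal.pow_right_mono hφI k (Ideal.map_pow φ (augIdeal εA) k ▸ Ideal.mem_map_of_mem φ ha)
  -- By `hmap` the image of `augIdeal εA` generates `augIdeal εC`, so the range of `φ` is adically
  -- dense.
  have happrox : ∀ (k : ℕ) (c : C), ∃ a, c - φ a ∈ augIdeal εC ^ k := fun k c => by
    obtain ⟨_, ⟨a, rfl⟩, h⟩ := exists_mem_sub_mem_pow εC φ.range (s := φ '' augIdeal εA)
      (by rintro _ ⟨a, -, rfl⟩; exact ⟨a, rfl⟩)
      (by rintro _ ⟨a, ha, rfl⟩; exact hφI (Ideal.mem_map_of_mem φ ha))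
      (hmap.trans le_sup_left) k c
    exact ⟨a, h⟩
  constructor
  · rw [injective_iff_map_eq_zero]
    intro f hf
    obtain ⟨f, rfl⟩ := Ideal.Quotient.mk_surjective f
    rw [Ideal.Quotient.eq_zero_iff_mem]
    replace hf : φ f ∈ augCoinvariantIdeal G εC := by
      rw [← Ideal.Quotient.eq_zero_iff_mem]
      exact hf
    -- The exponent `k + 1` is positive even when `k = 0`; hence an approximation of a generator has
    -- the same constant term, namely zero.
    have key : ∀ c ∈ augCoinvariantIdeal G εC,
        ∃ a ∈ augCoinvariantIdeal G εA, c - φ a ∈ augIdeal εC ^ (k + 1) := by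
      intro c hc
      induction hc using Submodule.span_induction with
      | zero => exact ⟨0, zero_mem _, by simp⟩
      | add c d _ _ hc hd =>
        obtain ⟨a, ha, hc⟩ := hc
        obtain ⟨b, hb, hd⟩ := hd
        exact ⟨a + b, add_mem ha hb, by simpa [add_sub_add_comm] using add_mem hc hd⟩
      | smul c d _ hd =>
        obtain ⟨b, hb, hd⟩ := hd
        obtain ⟨a, ha⟩ := happrox (k + 1) c
        refine ⟨a * b, Ideal.mul_mem_left _ _ hb, ?_⟩
        have : c • d - φ (a * b) = c * (d - φ b) + (c - φ a) * φ b := by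
          rw [smul_eq_mul, map_mul]; ring
        rw [this]
        exact add_mem (Ideal.mul_mem_left _ _ hd) (Ideal.mul_mem_right _ _ ha)
      | mem h hh =>
        obtain ⟨hinv, h0⟩ := hh
        obtain ⟨p, hp⟩ := happrox (k + 1) h
        -- Averaging fixes the invariant `h` and preserves the powers of the augmentation ideal, so
        -- the approximating element may be taken invariant.
        have h1 : h - φ (reynolds G p) ∈ augIdeal εC ^ (k + 1) := by
          have := reynolds_mem_augIdeal_pow G hC _ hp
          rwa [reynolds_sub, reynolds_of_invariant G hinv, ← map_reynolds G φ hφ] at this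
        refine ⟨reynolds G p, Ideal.subset_span ⟨fun g => smul_reynolds G g p, ?_⟩, h1⟩
        have h2 := Ideal.pow_le_self (Nat.succ_ne_zero k) h1
        rw [RingHom.mem_ker] at h2
        have h3 : εC h - εC (φ (reynolds G p)) = 0 := by rw [← map_sub]; exact h2
        rw [← hε]
        rw [h0, zero_sub, neg_eq_zero] at h3
        exact h3
    obtain ⟨a, ha, hfa⟩ := key _ hf
    obtain ⟨p, hp, hfp⟩ := exists_mem_sub_mem_pow εA (Algebra.adjoin ℂ (Set.range x))
      Algebra.subset_adjoin (by rintro _ ⟨i, rfl⟩; exact hx i) hgen k (f - a)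
    rw [Algebra.adjoin_range_eq_range_aeval] at hp
    obtain ⟨P, rfl⟩ := hp
    -- Both `f - a` and `f - a - P(x)` have images of order at least `k`, hence so does `P(x)`.
    have hP : P ∈ MvPolynomial.idealOfVars (Fin t) ℂ ^ k := by
      refine hpoly k P ?_
      have h1 := hφpow k _ hfp
      have h2 := Ideal.pow_le_pow_right (Nat.le_succ k) hfa
      rw [map_sub, map_sub] at h1
      simpa using sub_mem h2 h1
    have hPI : MvPolynomial.aeval x P ∈ augIdeal εA ^ k := by
      have h1 : (MvPolynomial.idealOfVars (Fin t) ℂ).map (MvPolynomial.aeval x : _ →ₐ[ℂ] A) ≤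
          augIdeal εA := by
        rw [Ideal.map_span, Ideal.span_le]
        rintro _ ⟨_, ⟨i, rfl⟩, rfl⟩
        simpa [RingHom.mem_ker] using hx i
      refine Ideal.pow_right_mono h1 k ?_
      rw [← Ideal.map_pow]
      exact Ideal.mem_map_of_mem _ hP
    have : f = a + ((f - a - MvPolynomial.aeval x P) + MvPolynomial.aeval x P) := by ring
    rw [this]
    exact add_mem ha (add_mem (hk hfp) (hk hPI))
  · intro c
    obtain ⟨c, rfl⟩ := Ideal.Quotient.mk_surjective c
    obtain ⟨a, ha⟩ := happrox k c
    refine ⟨Ideal.Quotient.mk _ a, ?_⟩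
    change Ideal.Quotient.mk _ (φ a) = _
    refine ((Ideal.Quotient.mk_eq_mk_iff_sub_mem _ _).2 ?_).symm
    have h1 := Ideal.pow_right_mono hmap k ha
    rw [← Ideal.map_pow] at h1
    exact Ideal.map_le_iff_le_comap.2 hJ (Ideal.map_mono hk h1)

end Comparison

/-! ### Order of vanishing of polynomials at the origin -/

section Polynomials

open Asymptotics

/-- The bound forces `q(0) = 0`; dividing by `s` on the punctured neighbourhood lowers the exponent
by one. -/
theorem X_pow_dvd_of_isBigO {k : ℕ} {q : Polynomial ℂ}
    (h : (fun s => q.eval s) =O[𝓝[≠] 0] fun s : ℂ => s ^ k) : Polynomial.X ^ k ∣ q := by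
  induction k generalizing q with
  | zero => simp
  | succ k ih =>
    have h0 : q.eval 0 = 0 := by
      have h1 : Tendsto (fun s : ℂ => s ^ (k + 1)) (𝓝[≠] 0) (𝓝 0) :=
        ((continuous_pow (k + 1)).tendsto' 0 0 (by simp)).mono_left nhdsWithin_le_nhds
      have h2 : Tendsto (fun s => q.eval s) (𝓝[≠] 0) (𝓝 (q.eval 0)) :=
        (q.continuous.tendsto 0).mono_left nhdsWithin_le_nhds
      exact tendsto_nhds_unique h2 (h.trans_tendsto h1)
    obtain ⟨r, rfl⟩ := (Polynomial.X_dvd_iff (f := q)).2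
      (by rwa [Polynomial.coeff_zero_eq_eval_zero])
    rw [pow_succ']
    refine mul_dvd_mul_left _ (ih ?_)
    have h3 := (isBigO_refl (fun s : ℂ => s⁻¹) (𝓝[≠] 0)).mul h
    refine (h3.congr' ?_ ?_) <;> filter_upwards [self_mem_nhdsWithin] with s hs
    · have : s ≠ 0 := hs
      simp [this]
    · have : s ≠ 0 := hs
      field_simp
      ring

theorem eval_smul_of_isHomogeneous {σ : Type*} {P : MvPolynomial σ ℂ} {i : ℕ}
    (hP : P.IsHomogeneous i) (s : ℂ) (u : σ → ℂ) :
    MvPolynomial.eval (s • u) P = MvPolynomial.eval u P * s ^ i := by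
  rw [MvPolynomial.eval_eq, MvPolynomial.eval_eq, Finset.sum_mul]
  refine Finset.sum_congr rfl fun d hd => ?_
  have := hP (MvPolynomial.mem_support_iff.1 hd)
  rw [← this, Finsupp.weight_apply, Finsupp.sum]
  simp [mul_pow, Finset.prod_mul_distrib, Finset.prod_pow_eq_pow_sum]
  ring

/-- On the line `s ↦ s • u` the polynomial `P` becomes a one-variable polynomial whose coefficients
are the values at `u` of the homogeneous components of `P`; those below degree `k` vanish for every
`u`. -/
theorem mem_pow_idealOfVars_of_isBigO {t k : ℕ} {P : MvPolynomial (Fin t) ℂ}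
    (h : (fun u => MvPolynomial.eval u P) =O[𝓝 0] fun u : Fin t → ℂ => ‖u‖ ^ k) :
    P ∈ MvPolynomial.idealOfVars (Fin t) ℂ ^ k := by
  have hcomp : ∀ j < k, MvPolynomial.homogeneousComponent j P = 0 := by
    intro j hj
    refine MvPolynomial.funext fun u => ?_
    rw [map_zero]
    set N := P.totalDegree + 1
    let q : Polynomial ℂ := ∑ i ∈ Finset.range N,
      Polynomial.monomial i (MvPolynomial.eval u (MvPolynomial.homogeneousComponent i P))
    have hq : ∀ s, q.eval s = MvPolynomial.eval (s • u) P := by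
      intro s
      conv_rhs => rw [← MvPolynomial.sum_homogeneousComponent P]
      rw [Polynomial.eval_finsetSum, map_sum]
      refine Finset.sum_congr rfl fun i _ => ?_
      rw [Polynomial.eval_monomial]
      have hh := MvPolynomial.homogeneousComponent_isHomogeneous i P
      exact (eval_smul_of_isHomogeneous hh s u).symm
    have hdvd : Polynomial.X ^ k ∣ q := by
      refine X_pow_dvd_of_isBigO ?_
      have h1 : Tendsto (fun s : ℂ => s • u) (𝓝[≠] 0) (𝓝 0) :=
        ((continuous_id.smul continuous_const).tendsto' 0 0 (by simp)).mono_left nhdsWithin_le_nhds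
      simp only [hq]
      refine (h.comp_tendsto h1).trans ?_
      refine IsBigO.of_bound (‖u‖ ^ k) (Eventually.of_forall fun s => ?_)
      simp [norm_smul, mul_pow, mul_comm]
    have := (Polynomial.X_pow_dvd_iff.1 hdvd) j hj
    rw [Polynomial.finsetSum_coeff] at this
    simp only [Polynomial.coeff_monomial, Finset.sum_ite_eq', Finset.mem_range] at this
    by_cases hjN : j < N
    · rwa [if_pos hjN] at this
    · rw [MvPolynomial.homogeneousComponent_eq_zero _ _ (by omega), map_zero]
  rw [MvPolynomial.mem_pow_idealOfVars_iff']
  intro d hd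
  have := congrArg (MvPolynomial.coeff d) (hcomp _ hd)
  simpa [MvPolynomial.coeff_homogeneousComponent] using this

end Polynomials

/-! ### The group action on germs -/

section GermAction

variable {G : Type*} [Group G] {V : Type*} [Group V] [MulDistribMulAction G V]

/-- Evaluation at the identity of germs along a filter that sees the identity. -/
def evalOne {l : Filter V} (h : pure 1 ≤ l) : Germ l ℂ →ₐ[ℂ] ℂ where
  toFun f := Germ.liftOn f (fun F => F 1) fun _ _ hF => h hF
  map_one' := rfl
  map_mul' x y := Germ.inductionOn₂ x y fun _ _ => rfl
  map_zero' := rfl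
  map_add' x y := Germ.inductionOn₂ x y fun _ _ => rfl
  commutes' r := by rw [algebraMap_germ]; rfl

theorem evalOne_coe {l : Filter V} (h : pure 1 ≤ l) (F : V → ℂ) :
    evalOne h (F : Germ l ℂ) = F 1 := rfl

theorem vanishesAtOne_iff {l : Filter V} (h : pure 1 ≤ l) (f : Germ l ℂ) :
    VanishesAtOne f ↔ evalOne h f = 0 := by
  constructor
  · rintro ⟨F, rfl, hF⟩
    exact hF
  · induction f using Germ.inductionOn with
    | h F => exact fun hF => ⟨F, rfl, hF⟩

/-- Pulling back germs along a map, as an algebra homomorphism. -/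
def germComp {X Y : Type*} {l : Filter X} {l' : Filter Y} (E : Y → X) (hE : Tendsto E l' l) :
    Germ l ℂ →ₐ[ℂ] Germ l' ℂ where
  toFun f := Germ.compTendsto f E hE
  map_one' := rfl
  map_mul' x y := Germ.inductionOn₂ x y fun _ _ => rfl
  map_zero' := rfl
  map_add' x y := Germ.inductionOn₂ x y fun _ _ => rfl
  commutes' r := by simp only [algebraMap_germ]; rfl

theorem germComp_coe {X Y : Type*} {l : Filter X} {l' : Filter Y} (E : Y → X)
    (hE : Tendsto E l' l) (F : X → ℂ) :
    germComp E hE (F : Germ l ℂ) = ((fun y => F (E y) : Y → ℂ) : Germ l' ℂ) := rfl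

variable {l : Filter V} (O : Subalgebra ℂ (Germ l ℂ))
  (hl : ∀ g : G, Tendsto (fun v : V => g • v) l l)
  (hO : ∀ (g : G), ∀ f ∈ O, germComp (fun v : V => g⁻¹ • v) (hl g⁻¹) f ∈ O)

/-- The action `(g • f)(v) = f (g⁻¹ • v)` on a stable algebra of germs. -/
abbrev germAction : MulSemiringAction G O where
  smul g f := ⟨germComp (fun v : V => g⁻¹ • v) (hl g⁻¹) f, hO g f f.2⟩
  one_smul := by
    rintro ⟨f, hf⟩
    refine Subtype.ext ?_
    change germComp (fun v : V => (1 : G)⁻¹ • v) _ f = f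
    induction f using Germ.inductionOn with
    | h F => simp [germComp_coe]
  mul_smul := by
    rintro g h ⟨f, hf⟩
    refine Subtype.ext ?_
    change germComp (fun v : V => (g * h)⁻¹ • v) _ f = germComp _ _ (germComp _ _ f)
    induction f using Germ.inductionOn with
    | h F => simp [germComp_coe, mul_smul]
  smul_zero g := Subtype.ext (map_zero (germComp (fun v : V => g⁻¹ • v) (hl g⁻¹)))
  smul_add g a b := Subtype.ext (map_add (germComp (fun v : V => g⁻¹ • v) (hl g⁻¹)) a.1 b.1)
  smul_one g := Subtype.ext (map_one (germComp (fun v : V => g⁻¹ • v) (hl g⁻¹)))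
  smul_mul g a b := Subtype.ext (map_mul (germComp (fun v : V => g⁻¹ • v) (hl g⁻¹)) a.1 b.1)

theorem isInvariantGerm_iff (f : Germ l ℂ) :
    IsInvariantGerm G f ↔ ∀ g : G, germComp (fun v : V => g⁻¹ • v) (hl g⁻¹) f = f := by
  constructor
  · rintro ⟨F, rfl, hF⟩ g
    exact Germ.coe_eq.2 (hF g)
  · induction f using Germ.inductionOn with
    | h F => exact fun h => ⟨F, rfl, fun g => Germ.coe_eq.1 (h g)⟩

/-- The augmentation of an algebra of germs at the identity. -/
abbrev germAug (h1 : pure 1 ≤ l) : O →ₐ[ℂ] ℂ := (evalOne h1).comp O.val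

theorem coinvariantIdeal_eq (h1 : pure 1 ≤ l) :
    coinvariantIdeal G O =
      @augCoinvariantIdeal O _ _ G _ (germAction O hl hO) (germAug O h1) := by
  rw [coinvariantIdeal, augCoinvariantIdeal]
  congr 1
  ext f
  simp only [Set.mem_ofPred_eq, isInvariantGerm_iff hl, vanishesAtOne_iff h1]
  exact and_congr (forall_congr' fun g => (Subtype.ext_iff (a1 := ⟨germComp (fun v : V => g⁻¹ • v)
    (hl g⁻¹) f, hO g f f.2⟩) (a2 := f)).symm) Iff.rfl

theorem germAug_smul (h1 : pure 1 ≤ l) (g : G) (f : O) :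
    germAug O h1 ⟨germComp (fun v : V => g⁻¹ • v) (hl g⁻¹) f, hO g f f.2⟩ = germAug O h1 f := by
  obtain ⟨f, hf⟩ := f
  change evalOne h1 (germComp _ (hl g⁻¹) f) = evalOne h1 f
  induction f using Germ.inductionOn with
  | h F => simp [germComp_coe, evalOne_coe]

end GermAction

/-! ### Pulling germs back along a parametrization -/

section Pullback

open Asymptotics

variable {V : Type*} {l : Filter V} {t : ℕ}

theorem isBigO_of_coe_eq {E : (Fin t → ℂ) → V} (hE : Tendsto E (𝓝 0) l)
    {f : Germ l ℂ} {F F' : V → ℂ} (hF : (F : Germ l ℂ) = f)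
    (hF' : (F' : Germ l ℂ) = f) {r : (Fin t → ℂ) → ℝ}
    (h : (fun u => F (E u)) =O[𝓝 0] r) : (fun u => F' (E u)) =O[𝓝 0] r :=
  h.congr' (hE (Germ.coe_eq.1 (hF.trans hF'.symm))) EventuallyEq.rfl

/-- First-order estimates multiply, so a bound for the augmentation ideal alone controls all of its
powers. -/
theorem isBigO_of_mem_augIdeal_pow [Group V] (h1 : pure 1 ≤ l) (C : Subalgebra ℂ (Germ l ℂ))
    {E : (Fin t → ℂ) → V}
    (hC : ∀ f ∈ augIdeal (germAug C h1), ∃ F : V → ℂ, (F : Germ l ℂ) = f ∧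
      (fun u => F (E u)) =O[𝓝 0] fun u => ‖u‖) (k : ℕ) :
    ∀ f ∈ augIdeal (germAug C h1) ^ k, ∃ F : V → ℂ, (F : Germ l ℂ) = f ∧
      (fun u => F (E u)) =O[𝓝 0] fun u => ‖u‖ ^ k := by
  induction k with
  | zero =>
    intro f _
    obtain ⟨F, hF, hFO⟩ := hC _ (sub_algebraMap_mem_augIdeal _ f)
    -- The zeroth power is the whole algebra: a germ is its constant term plus an element of the
    -- augmentation ideal, hence bounded along `E`.
    refine ⟨fun v => F v + germAug C h1 f, ?_, ?_⟩
    · change (F : Germ l ℂ) + ((fun _ => germAug C h1 f : V → ℂ) : Germ l ℂ) = _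
      rw [hF, ← algebraMap_germ]
      change ((f : Germ l ℂ) - algebraMap ℂ (Germ l ℂ) _) + _ = _
      simp
    · have h2 : (fun u : Fin t → ℂ => ‖u‖) =O[𝓝 0] fun u => ‖u‖ ^ 0 := by
        simpa using (continuous_norm.tendsto (0 : Fin t → ℂ)).isBigO_one ℝ
      refine (hFO.trans h2).add ?_
      simpa using isBigO_const_const (germAug C h1 f) (one_ne_zero (α := ℝ)) (𝓝 (0 : Fin t → ℂ))
  | succ k ih =>
    intro f hf
    rw [pow_succ] at hf
    induction hf using Submodule.mul_induction_on' with
    | mem_mul_mem a ha b hb =>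
      obtain ⟨F, hF, hFO⟩ := ih a ha
      obtain ⟨F', hF', hFO'⟩ := hC b hb
      refine ⟨F * F', ?_, ?_⟩
      · rw [Germ.coe_mul, hF, hF']; rfl
      · simp only [pow_succ]
        exact hFO.mul hFO'
    | add a _ b _ ha hb =>
      obtain ⟨F, hF, hFO⟩ := ha
      obtain ⟨F', hF', hFO'⟩ := hb
      exact ⟨F + F', by rw [Germ.coe_add, hF, hF']; rfl, hFO.add hFO'⟩

theorem coe_eval_eq_aeval {X : Fin t → V → ℂ} {x : Fin t → Germ l ℂ}
    (hX : ∀ i, (X i : Germ l ℂ) = x i) (P : MvPolynomial (Fin t) ℂ) :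
    ((fun v => MvPolynomial.eval (fun i => X i v) P : V → ℂ) : Germ l ℂ) =
      MvPolynomial.aeval x P := by
  induction P using MvPolynomial.induction_on with
  | C a => simp [algebraMap_germ]
  | add p q hp hq => simp only [map_add, ← hp, ← hq]; rfl
  | mul_X p i hp =>
    simp only [map_mul, ← hp, MvPolynomial.aeval_X, ← hX, MvPolynomial.eval_X]; rfl

end Pullback

/-! ### The comparison theorem for algebras of germs -/

section Main

open Asymptotics

variable {G : Type*} [Group G] [Finite G] {V : Type*} [Group V] [MulDistribMulAction G V]
  {l l' : Filter V} {t : ℕ}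

/-- Comparison of coinvariants of two stable algebras of germs, the bigger of which is locally
given by functions on the parameter space of a map `E` inverting the coordinates `x`. -/
theorem coinvariantMap_bijective_and_finrank_le (h : l' ≤ l) (A : Subalgebra ℂ (Germ l ℂ))
    (C : Subalgebra ℂ (Germ l' ℂ)) (hAC : A ≤ C.comap (germRestrict h)) (h1 : pure 1 ≤ l')
    (hl : ∀ g : G, Tendsto (fun v : V => g • v) l l)
    (hl' : ∀ g : G, Tendsto (fun v : V => g • v) l' l')
    (hA : ∀ (g : G), ∀ f ∈ A, germComp (fun v : V => g⁻¹ • v) (hl g⁻¹) f ∈ A)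
    (hC : ∀ (g : G), ∀ f ∈ C, germComp (fun v : V => g⁻¹ • v) (hl' g⁻¹) f ∈ C)
    (x : Fin t → A) (hx : ∀ i, germAug A (h1.trans h) (x i) = 0)
    (hfg : (augIdeal (germAug A (h1.trans h))).FG)
    (hgen : augIdeal (germAug A (h1.trans h)) ≤
      Ideal.span (Set.range x) ⊔ augIdeal (germAug A (h1.trans h)) ^ 2)
    (hmap : augIdeal (germAug C h1) ≤
      (augIdeal (germAug A (h1.trans h))).map (restrictHom h A C hAC))
    (E : (Fin t → ℂ) → V) (hE : Tendsto E (𝓝 0) l')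
    (X : Fin t → V → ℂ) (hX : ∀ i, (X i : Germ l ℂ) = x i)
    (hEX : ∀ᶠ u in 𝓝 0, ∀ i, X i (E u) = u i)
    (hEC : ∀ f ∈ augIdeal (germAug C h1), ∃ F : V → ℂ, (F : Germ l' ℂ) = f ∧
      (fun u => F (E u)) =O[𝓝 0] fun u => ‖u‖) :
    Function.Bijective (coinvariantMap G h A C hAC) ∧
      Module.Finite ℂ (CoinvariantSpace G C) ∧
      Module.finrank ℂ (CoinvariantSpace G C) ≤ Nat.card G ^ t := by
  let _ := germAction A hl hA
  let _ := germAction C hl' hC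
  have : SMulCommClass G ℂ A := ⟨fun g r f => Subtype.ext
    (map_smul (germComp (fun v : V => g⁻¹ • v) (hl g⁻¹)) r f.1)⟩
  have hJA : coinvariantIdeal G A = augCoinvariantIdeal G (germAug A (h1.trans h)) :=
    coinvariantIdeal_eq A hl hA _
  have hJC : coinvariantIdeal G C = augCoinvariantIdeal G (germAug C h1) :=
    coinvariantIdeal_eq C hl' hC _
  have hAinv : ∀ (g : G) (a : A), germAug A (h1.trans h) (g • a) = germAug A (h1.trans h) a :=
    germAug_smul A hl hA _
  have hCinv : ∀ (g : G) (a : C), germAug C h1 (g • a) = germAug C h1 a :=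
    germAug_smul C hl' hC _
  have hφ : ∀ (g : G) (a : A), restrictHom h A C hAC (g • a) = g • restrictHom h A C hAC a := by
    rintro g ⟨f, hf⟩
    refine Subtype.ext ?_
    change germRestrict h (germComp _ (hl g⁻¹) f) = germComp _ (hl' g⁻¹) (germRestrict h f)
    induction f using Germ.inductionOn with
    | h F => rfl
  have hε : ∀ a, germAug C h1 (restrictHom h A C hAC a) = germAug A (h1.trans h) a := by
    rintro ⟨f, hf⟩
    change evalOne h1 (germRestrict h f) = evalOne (h1.trans h) f
    induction f using Germ.inductionOn with
    | h F => rfl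
  -- Since `X i (E u) = u i` near `0`, pulling `P(x)` back along `E` gives `P` itself, and
  -- membership in the `k`-th power becomes an estimate `O(‖u‖ ^ k)`.
  have hpoly : ∀ (k : ℕ) (P : MvPolynomial (Fin t) ℂ),
      restrictHom h A C hAC (MvPolynomial.aeval x P) ∈ augIdeal (germAug C h1) ^ k →
      P ∈ MvPolynomial.idealOfVars (Fin t) ℂ ^ k := by
    intro k P hP
    obtain ⟨F, hF, hFO⟩ := isBigO_of_mem_augIdeal_pow h1 C hEC k _ hP
    refine mem_pow_idealOfVars_of_isBigO ?_
    have h2 : ((fun v => MvPolynomial.eval (fun i => X i v) P : V → ℂ) : Germ l' ℂ) =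
        restrictHom h A C hAC (MvPolynomial.aeval x P) := by
      change _ = germRestrict h (A.val (MvPolynomial.aeval x P))
      have h3 : A.val (MvPolynomial.aeval x P) = MvPolynomial.aeval (fun i => A.val (x i)) P :=
        (MvPolynomial.comp_aeval_apply x A.val P)
      rw [h3, ← coe_eval_eq_aeval (x := fun i => A.val (x i)) hX P]
      rfl
    refine (isBigO_of_coe_eq hE hF h2 hFO).congr' ?_ EventuallyEq.rfl
    filter_upwards [hEX] with u hu
    simp [hu]
  have hJ : augCoinvariantIdeal G (germAug A (h1.trans h)) ≤
      (augCoinvariantIdeal G (germAug C h1)).comap (restrictHom h A C hAC) := by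
    rw [← hJA, ← hJC]
    exact coinvariantIdeal_le_comap G h A C hAC
  have hbij : Function.Bijective (coinvariantMap G h A C hAC) := by
    -- The quotient types depend on the ideals, so the ideals are generalized before the equalities
    -- are substituted.
    have gen : ∀ (JA : Ideal A) (JC : Ideal C) (hJ' : JA ≤ JC.comap (restrictHom h A C hAC)),
        JA = augCoinvariantIdeal G (germAug A (h1.trans h)) →
        JC = augCoinvariantIdeal G (germAug C h1) →
        Function.Bijective (Ideal.quotientMapₐ JC (restrictHom h A C hAC) hJ') := by
      rintro _ _ hJ' rfl rfl
      exact bijective_quotientMap_augCoinvariantIdeal G hAinv hCinv hφ hε hx hfg hgen hmap hpoly hJ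
    exact gen _ _ _ hJA hJC
  have hfin : Module.Finite ℂ (CoinvariantSpace G A) ∧
      Module.finrank ℂ (CoinvariantSpace G A) ≤ Nat.card G ^ t := by
    have := finrank_quotient_augCoinvariantIdeal_le G hAinv hx hfg hgen
    rw [← hJA] at this
    exact this
  let e := LinearEquiv.ofBijective (coinvariantMap G h A C hAC).toLinearMap hbij
  have := hfin.1
  exact ⟨hbij, Module.Finite.equiv e, e.finrank_eq ▸ hfin.2⟩

end Main

/-- An analytic Hadamard lemma: `S` is the sum of the shifted power series, in which one argument of
each multilinear term is left free. It writes a function vanishing at `z` as a combination of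
coordinates with analytic coefficients. -/
theorem exists_analyticAt_eq_add_apply {E E' : Type*} [NormedAddCommGroup E] [NormedSpace ℂ E]
    [NormedAddCommGroup E'] [NormedSpace ℂ E'] [CompleteSpace E'] {F : E → E'} {z : E}
    (hF : AnalyticAt ℂ F z) :
    ∃ S : E → (E →L[ℂ] E'), AnalyticAt ℂ S z ∧ ∀ᶠ y in 𝓝 z, F y = F z + S y (y - z) := by
  obtain ⟨p, r, hp⟩ := hF
  obtain ⟨q, hq⟩ : ∃ q, q = p.shift := ⟨_, rfl⟩
  have hqp : ∀ (n : ℕ) (y : E), q n (fun _ => y) y = p (n + 1) fun _ => y := by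
    intro n y
    rw [hq, FormalMultilinearSeries.shift, ContinuousMultilinearMap.curryRight_apply]
    congr 1
    funext i
    refine Fin.lastCases ?_ (fun j => ?_) i <;> simp
  have hr : 0 < q.radius := by
    rw [hq, p.radius_shift]; exact hp.r_pos.trans_le hp.r_le
  have hqs := q.hasFPowerSeriesOnBall hr
  refine ⟨fun y => q.sum (y - z), by simpa using (hqs.comp_sub z).analyticAt, ?_⟩
  have h2 : ∀ᶠ y in 𝓝 z, HasSum (fun n => q n fun _ => y - z) (q.sum (y - z)) := by
    have h3 : Tendsto (fun y => y - z) (𝓝 z) (𝓝 0) := by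
      simpa using (continuous_id.sub continuous_const).tendsto (f := fun y : E => y - z) z
    filter_upwards [h3.eventually hqs.eventually_hasSum] with y hy
    simpa using hy
  filter_upwards [hp.eventually_hasSum_sub, h2] with y hy1 hy2
  have h4 : HasSum (fun n => p (n + 1) fun _ => y - z) (q.sum (y - z) (y - z)) := by
    simpa only [ContinuousLinearMap.apply_apply, hqp] using
      (ContinuousLinearMap.apply ℂ E' (y - z)).hasSum hy2
  rw [hy1.unique h4.zero_add, hp.coeff_zero]

/-! ### Generators of augmentation ideals -/

section ConstSubalgebra

variable {R : Type*} [CommRing R] [Algebra ℂ R]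

/-- The elements of an augmented algebra that are congruent to constants modulo an ideal. -/
def constSubalgebra (ε : R →ₐ[ℂ] ℂ) (I : Ideal R) : Subalgebra ℂ R where
  carrier := {a | a - algebraMap ℂ R (ε a) ∈ I}
  algebraMap_mem' r := by simp
  add_mem' {a b} ha hb := by simpa [add_sub_add_comm] using add_mem ha hb
  mul_mem' {a b} ha hb := by
    have : a * b - algebraMap ℂ R (ε (a * b)) = a * (b - algebraMap ℂ R (ε b)) +
        algebraMap ℂ R (ε b) * (a - algebraMap ℂ R (ε a)) := by
      rw [map_mul, map_mul]; ring
    change a * b - _ ∈ I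
    rw [this]
    exact add_mem (Ideal.mul_mem_left _ _ hb) (Ideal.mul_mem_left _ _ ha)

theorem mem_constSubalgebra {ε : R →ₐ[ℂ] ℂ} {I : Ideal R} {a : R} :
    a ∈ constSubalgebra ε I ↔ a - algebraMap ℂ R (ε a) ∈ I := Iff.rfl

/-- The difference `b - ε b` is a multiple of `a - ε a`. This handles the inverse determinant and
the denominators of fractions. -/
theorem mem_constSubalgebra_of_mul_eq_one {ε : R →ₐ[ℂ] ℂ} {I : Ideal R} {a b : R}
    (h : a * b = 1) (ha : a ∈ constSubalgebra ε I) : b ∈ constSubalgebra ε I := by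
  rw [mem_constSubalgebra] at ha ⊢
  have h1 : algebraMap ℂ R (ε a) * algebraMap ℂ R (ε b) = 1 := by
    rw [← map_mul, ← map_mul, h, map_one, map_one]
  have h2 : b - algebraMap ℂ R (ε b) =
      -(b * algebraMap ℂ R (ε b)) * (a - algebraMap ℂ R (ε a)) := by
    linear_combination (-b) * h1 + algebraMap ℂ R (ε b) * h
  rw [h2]
  exact Ideal.mul_mem_left _ _ ha

/-- It reduces an inclusion of ideals to a check on algebra generators, because the elements
congruent to constants form a subalgebra. -/
theorem augIdeal_le_of_constSubalgebra_eq_top {ε : R →ₐ[ℂ] ℂ} {I : Ideal R}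
    (h : constSubalgebra ε I = ⊤) : augIdeal ε ≤ I := by
  intro f hf
  have h1 : f ∈ constSubalgebra ε I := h ▸ Algebra.mem_top
  have h2 : ε f = 0 := hf
  simpa [mem_constSubalgebra, h2] using h1

theorem augIdeal_le_span_of_adjoin_eq_top (ε : R →ₐ[ℂ] ℂ) {s : Set R}
    (hs : Algebra.adjoin ℂ s = ⊤) (h0 : ∀ a ∈ s, ε a = 0) : augIdeal ε ≤ Ideal.span s := by
  refine augIdeal_le_of_constSubalgebra_eq_top (top_unique (hs ▸ Algebra.adjoin_le fun a ha => ?_))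
  change a - algebraMap ℂ R (ε a) ∈ Ideal.span s
  simpa [h0 a ha] using Ideal.subset_span ha

end ConstSubalgebra

/-! ### Complex Lie groups in linearizing coordinates -/

section LieGroup

open Asymptotics

variable {G : Type*} [Group G] {n : ℕ} {V : Type*} [TopologicalSpace V]
  [ChartedSpace (Fin n → ℂ) V] [Group V] [MulDistribMulAction G V]
  {x : OpenPartialHomeomorph V (Fin n → ℂ)}

theorem IsLinearizingChart.symm_zero (hx : IsLinearizingChart G x) : x.symm 0 = 1 := by
  rw [← hx.map_one, x.left_inv hx.one_mem_source]

theorem IsLinearizingChart.zero_mem_target (hx : IsLinearizingChart G x) :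
    (0 : Fin n → ℂ) ∈ x.target := by
  rw [← hx.map_one]; exact x.map_source hx.one_mem_source

theorem IsLinearizingChart.tendsto_symm (hx : IsLinearizingChart G x) :
    Tendsto x.symm (𝓝 0) (𝓝 1) := by
  have := x.continuousAt_symm hx.zero_mem_target
  rwa [ContinuousAt, hx.symm_zero] at this

theorem IsLinearizingChart.tendsto (hx : IsLinearizingChart G x) :
    Tendsto x (𝓝 1) (𝓝 0) := by
  have := x.continuousAt hx.one_mem_source
  rwa [ContinuousAt, hx.map_one] at this

theorem IsLinearizingChart.analyticAt_comp_symm [IsManifold 𝓘(ℂ, Fin n → ℂ) ω V]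
    (hx : IsLinearizingChart G x) {F : V → ℂ}
    (hF : ContMDiffAt 𝓘(ℂ, Fin n → ℂ) 𝓘(ℂ) ω F 1) : AnalyticAt ℂ (fun u => F (x.symm u)) 0 := by
  have h1 := contMDiffAt_symm_of_mem_maximalAtlas hx.mem_maximalAtlas hx.zero_mem_target
  have h2 : ContMDiffAt 𝓘(ℂ, Fin n → ℂ) 𝓘(ℂ) ω (F ∘ x.symm) 0 :=
    ContMDiffAt.comp 0 (by rwa [hx.symm_zero]) h1
  exact h2.contDiffAt.analyticAt

theorem IsLinearizingChart.comp_mem_holGerms (hx : IsLinearizingChart G x)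
    {H : (Fin n → ℂ) → ℂ} (hH : AnalyticAt ℂ H 0) :
    ((fun v => H (x v) : V → ℂ) : Germ (𝓝 (1 : V)) ℂ) ∈ holGerms n V := by
  refine ⟨_, rfl, ?_⟩
  filter_upwards [hx.tendsto.eventually hH.eventually_analyticAt,
    x.open_source.mem_nhds hx.one_mem_source] with v hv hvs
  exact (hv.contDiffAt.contMDiffAt (n := ω)).comp v
    (contMDiffAt_of_mem_maximalAtlas hx.mem_maximalAtlas hvs)

/-- The general comparison is applied with `E` the inverse chart. Invariance of the span makes the
polynomial germs stable under `G`, and the coordinates generate their augmentation ideal outright.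
-/
theorem IsLinearizingChart.coinvariantMap_bijective_and_finrank_le [Finite G]
    [IsManifold 𝓘(ℂ, Fin n → ℂ) ω V] (hx : IsLinearizingChart G x)
    (hG : ∀ g : G, ContMDiff 𝓘(ℂ, Fin n → ℂ) 𝓘(ℂ, Fin n → ℂ) ω (fun v : V => g • v)) :
    Function.Bijective
      (coinvariantMap G le_rfl (polyGerms x) (holGerms n V) (polyGerms_le_holGerms hx)) ∧
    Module.Finite ℂ (CoinvariantSpace G (holGerms n V)) ∧
    Module.finrank ℂ (CoinvariantSpace G (holGerms n V)) ≤ Nat.card G ^ n := by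
  have hl : ∀ g : G, Tendsto (fun v : V => g • v) (𝓝 1) (𝓝 1) := fun g => by
    simpa using (hG g).continuous.tendsto 1
  let X : Fin n → polyGerms x := fun i => ⟨coordGerm x i, Algebra.subset_adjoin ⟨i, rfl⟩⟩
  have hX0 : ∀ i, germAug (polyGerms x) (pure_le_nhds 1) (X i) = 0 := fun i => by
    change x 1 i = 0
    simp [hx.map_one]
  have hspan : augIdeal (germAug (polyGerms x) (pure_le_nhds 1)) ≤ Ideal.span (Set.range X) := by
    refine augIdeal_le_span_of_adjoin_eq_top _ ?_ (by rintro _ ⟨i, rfl⟩; exact hX0 i)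
    have h1 : Set.range X = ((↑) : polyGerms x → Germ (𝓝 (1 : V)) ℂ) ⁻¹'
        (Set.range (coordGerm x)) := by
      ext f
      constructor
      · rintro ⟨i, rfl⟩; exact ⟨i, rfl⟩
      · rintro ⟨i, hi⟩; exact ⟨i, Subtype.ext hi⟩
    rw [h1]
    exact Algebra.adjoin_adjoin_coe_preimage
  refine Coinvariants.coinvariantMap_bijective_and_finrank_le le_rfl (polyGerms x) (holGerms n V)
    (polyGerms_le_holGerms hx) (pure_le_nhds 1) hl hl ?_ ?_ X hX0 ?_ (hspan.trans le_sup_left) ?_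
    x.symm hx.tendsto_symm (fun i v => x v i) (fun i => rfl) ?_ ?_
  · intro g f hf
    have h1 : polyGerms x ≤ (polyGerms x).comap (germComp (fun v : V => g⁻¹ • v) (hl g⁻¹)) := by
      refine Algebra.adjoin_le ?_
      rintro _ ⟨i, rfl⟩
      exact Algebra.span_le_adjoin ℂ _ (hx.span_invariant g i)
    exact h1 hf
  · rintro g _ ⟨F, rfl, hF⟩
    refine ⟨_, rfl, ?_⟩
    filter_upwards [(hl g⁻¹).eventually hF] with v hv
    exact hv.comp v (hG g⁻¹ v)
  · have h1 : augIdeal (germAug (polyGerms x) (pure_le_nhds 1)) = Ideal.span (Set.range X) := by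
      refine le_antisymm hspan (Ideal.span_le.2 ?_)
      rintro _ ⟨i, rfl⟩; exact hX0 i
    exact h1 ▸ Submodule.fg_span (Set.finite_range X)
  · rintro ⟨f, F, rfl, hF⟩ hf0
    replace hf0 : F 1 = 0 := hf0
    obtain ⟨S, hS, hFS⟩ := exists_analyticAt_eq_add_apply (hx.analyticAt_comp_symm hF.self_of_nhds)
    -- The coefficients of the division `F = ∑ x i * c i`, from evaluating the analytic linear form
    -- `S` on the standard basis.
    let c : Fin n → holGerms n V := fun i => ⟨_, hx.comp_mem_holGerms
      (H := fun u => S u (Pi.single i 1))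
      ((ContinuousLinearMap.apply ℂ ℂ (Pi.single i 1 : Fin n → ℂ)).analyticAt _ |>.comp hS)⟩
    have hsum : (⟨(F : Germ (𝓝 (1 : V)) ℂ), F, rfl, hF⟩ : holGerms n V) =
        ∑ i, restrictHom le_rfl _ _ (polyGerms_le_holGerms hx) (X i) * c i := by
      refine Subtype.ext ?_
      rw [AddSubmonoidClass.coe_finsetSum]
      have h2 : (F : Germ (𝓝 (1 : V)) ℂ) =
          ((∑ i, (fun v => x v i) * fun v => S (x v) (Pi.single i 1) : V → ℂ) : Germ _ ℂ) := by
        refine Germ.coe_eq.2 ?_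
        filter_upwards [hx.tendsto.eventually hFS, x.open_source.mem_nhds hx.one_mem_source]
          with v hv hvs
        rw [x.left_inv hvs, hx.symm_zero, hf0, zero_add, sub_zero] at hv
        rw [hv, Finset.sum_apply]
        refine ((congrArg (S (x v)) (pi_eq_sum_univ' (x v))).trans (map_sum _ _ _)).trans ?_
        refine Finset.sum_congr rfl fun i _ => ?_
        simp
      exact h2.trans (map_sum (Germ.coeRingHom (𝓝 (1 : V))) _ _)
    rw [hsum]
    exact sum_mem fun i _ => Ideal.mul_mem_right _ _ (Ideal.mem_map_of_mem _ (hX0 i))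
  · filter_upwards [x.open_target.mem_nhds hx.zero_mem_target] with u hu i
    rw [x.right_inv hu]
  · rintro ⟨f, F, rfl, hF⟩ hf0
    replace hf0 : F 1 = 0 := hf0
    refine ⟨F, rfl, ?_⟩
    have := (hx.analyticAt_comp_symm hF.self_of_nhds).differentiableAt.isBigO_sub
    simpa [hx.symm_zero, hf0] using this.norm_right

end LieGroup

/-! ### Linearizing the action by averaging a chart -/

section Linearization

variable {G : Type*} [Group G] {n : ℕ} {V : Type*} [TopologicalSpace V]
  [Group V] [MulDistribMulAction G V]

/-- The action of `g` in a chart. -/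
def chartAction (φ : OpenPartialHomeomorph V (Fin n → ℂ)) (g : G) (u : Fin n → ℂ) : Fin n → ℂ :=
  φ (g • φ.symm u)

variable {φ : OpenPartialHomeomorph V (Fin n → ℂ)}

theorem chartAction_apply_chart (h1 : (1 : V) ∈ φ.source) (g : G) :
    chartAction φ g (φ 1) = φ 1 := by
  simp [chartAction, φ.left_inv h1]

theorem contDiffAt_chartAction [ChartedSpace (Fin n → ℂ) V] [IsManifold 𝓘(ℂ, Fin n → ℂ) ω V]
    (hφ : φ ∈ IsManifold.maximalAtlas 𝓘(ℂ, Fin n → ℂ) ω V) (h1 : (1 : V) ∈ φ.source) {g : G}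
    (hg : ContMDiff 𝓘(ℂ, Fin n → ℂ) 𝓘(ℂ, Fin n → ℂ) ω (fun v : V => g • v)) :
    ContDiffAt ℂ ω (chartAction φ g) (φ 1) := by
  rw [← contMDiffAt_iff_contDiffAt]
  have h2 := contMDiffAt_symm_of_mem_maximalAtlas hφ (φ.map_source h1)
  have h3 : g • φ.symm (φ 1) = 1 := by simp [φ.left_inv h1]
  have h4 : ContMDiffAt 𝓘(ℂ, Fin n → ℂ) 𝓘(ℂ, Fin n → ℂ) ω φ (g • φ.symm (φ 1)) := by
    rw [h3]; exact contMDiffAt_of_mem_maximalAtlas hφ h1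
  exact h4.comp (φ 1) ((hg _).comp (φ 1) h2)

theorem chartAction_mul_eventuallyEq (h1 : (1 : V) ∈ φ.source) (g : G) {h : G}
    (hh : Continuous fun v : V => h • v) :
    ∀ᶠ u in 𝓝 (φ 1), chartAction φ g (chartAction φ h u) = chartAction φ (g * h) u := by
  have h2 : Tendsto (fun u => h • φ.symm u) (𝓝 (φ 1)) (𝓝 1) := by
    have h3 := φ.continuousAt_symm (φ.map_source h1)
    have h4 := (hh.tendsto _).comp h3
    rwa [φ.left_inv h1, smul_one] at h4
  filter_upwards [h2.eventually (φ.open_source.mem_nhds h1)] with u hu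
  rw [chartAction, chartAction, φ.left_inv hu, chartAction, mul_smul]

variable (φ) in
/-- The derivative of the action in a chart. -/
def chartDeriv (g : G) : (Fin n → ℂ) →L[ℂ] (Fin n → ℂ) := fderiv ℂ (chartAction φ g) (φ 1)

variable (φ) in
/-- The average of the chart over the group, which intertwines the action with its derivative. -/
def averagedChart (G : Type*) [Group G] [Fintype G] [MulDistribMulAction G V] (u : Fin n → ℂ) :
    Fin n → ℂ :=
  (Fintype.card G : ℂ)⁻¹ • ∑ g : G, chartDeriv φ g⁻¹ (chartAction φ g u - φ 1)

variable [Fintype G] [ChartedSpace (Fin n → ℂ) V] [IsManifold 𝓘(ℂ, Fin n → ℂ) ω V]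
  (hφ : φ ∈ IsManifold.maximalAtlas 𝓘(ℂ, Fin n → ℂ) ω V) (h1 : (1 : V) ∈ φ.source)
  (hG : ∀ g : G, ContMDiff 𝓘(ℂ, Fin n → ℂ) 𝓘(ℂ, Fin n → ℂ) ω (fun v : V => g • v))

include hφ h1 hG

omit [Fintype G] in
theorem hasFDerivAt_chartAction (g : G) :
    HasFDerivAt (chartAction φ g) (chartDeriv φ g) (φ 1) :=
  ((contDiffAt_chartAction hφ h1 (hG g)).differentiableAt (by simp)).hasFDerivAt

-- The chain rule at the common fixed point `φ 1`: the derivatives form a linear representation of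
-- `G`.
omit [Fintype G] in
theorem chartDeriv_mul (g h : G) : chartDeriv φ (g * h) = chartDeriv φ g ∘L chartDeriv φ h := by
  have h2 : HasFDerivAt (chartAction φ g) (chartDeriv φ g) (chartAction φ h (φ 1)) := by
    rw [chartAction_apply_chart h1]
    exact hasFDerivAt_chartAction hφ h1 hG g
  have h3 := h2.comp (φ 1) (hasFDerivAt_chartAction hφ h1 hG h)
  refine ((hasFDerivAt_chartAction hφ h1 hG (g * h)).unique (h3.congr_of_eventuallyEq ?_))
  filter_upwards [chartAction_mul_eventuallyEq h1 g (hG h).continuous] with u hu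
  exact hu.symm

omit [Fintype G] in
theorem chartDeriv_one : chartDeriv φ (1 : G) = ContinuousLinearMap.id ℂ _ := by
  refine (hasFDerivAt_chartAction hφ h1 hG (1 : G)).unique
    ((hasFDerivAt_id (φ 1)).congr_of_eventuallyEq ?_)
  filter_upwards [φ.open_target.mem_nhds (φ.map_source h1)] with u hu
  simp [chartAction, φ.right_inv hu]

/-- Each summand has derivative `ρ(g⁻¹) ρ(g) = 1`, where `ρ` is `chartDeriv`, so the average does
too, and the inverse function theorem applies. -/
theorem hasFDerivAt_averagedChart :
    HasFDerivAt (averagedChart φ G)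
      ((ContinuousLinearEquiv.refl ℂ (Fin n → ℂ) : (Fin n → ℂ) →L[ℂ] (Fin n → ℂ))) (φ 1) := by
  have h2 : HasFDerivAt (averagedChart φ G) ((Fintype.card G : ℂ)⁻¹ •
      ∑ g : G, chartDeriv φ g⁻¹ ∘L chartDeriv φ g) (φ 1) :=
    (HasFDerivAt.fun_sum fun g _ => (chartDeriv φ g⁻¹).hasFDerivAt.comp (φ 1)
      ((hasFDerivAt_chartAction hφ h1 hG g).sub_const (φ 1))).const_smul (Fintype.card G : ℂ)⁻¹
  convert h2 using 1
  simp only [← chartDeriv_mul hφ h1 hG, inv_mul_cancel, chartDeriv_one hφ h1 hG]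
  ext u
  simp [← Nat.cast_smul_eq_nsmul ℂ]

theorem contDiffAt_averagedChart : ContDiffAt ℂ ω (averagedChart φ G) (φ 1) :=
  (ContDiffAt.sum fun g _ => (chartDeriv φ g⁻¹).contDiff.contDiffAt.comp (φ 1)
    ((contDiffAt_chartAction hφ h1 (hG g)).sub contDiffAt_const)).const_smul _

/-- Reindex the sum by `g ↦ g h` and use `ρ(g⁻¹) = ρ(h) ρ((g h)⁻¹)`. -/
theorem averagedChart_chartAction (h : G) :
    ∀ᶠ u in 𝓝 (φ 1),
      averagedChart φ G (chartAction φ h u) = chartDeriv φ h (averagedChart φ G u) := by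
  have h2 : ∀ᶠ u in 𝓝 (φ 1), ∀ g : G,
      chartAction φ g (chartAction φ h u) = chartAction φ (g * h) u :=
    eventually_all.2 fun g => chartAction_mul_eventuallyEq h1 g (hG h).continuous
  filter_upwards [h2] with u hu
  rw [averagedChart, averagedChart, map_smul, map_sum]
  congr 1
  refine Fintype.sum_equiv (Equiv.mulRight h) _ _ fun g => ?_
  rw [hu, ← ContinuousLinearMap.comp_apply, ← chartDeriv_mul hφ h1 hG]
  simp

/-- The new chart is `φ` followed by the averaged map, which is locally invertible. In it each `g`
acts by the matrix `chartDeriv φ g`, so translated coordinates are linear combinations of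
coordinates. -/
theorem exists_isLinearizingChart_of_chart :
    ∃ x : OpenPartialHomeomorph V (Fin n → ℂ), IsLinearizingChart G x := by
  have hY := contDiffAt_averagedChart (G := G) hφ h1 hG
  have hY' := hasFDerivAt_averagedChart (G := G) hφ h1 hG
  have hY0 : averagedChart φ G (φ 1) = 0 := by
    simp [averagedChart, chartAction_apply_chart h1]
  set Y := averagedChart φ G with hYdef
  let ψ := hY.toOpenPartialHomeomorph Y hY' (by simp)
  have hψ1 : φ 1 ∈ ψ.source := hY.mem_toOpenPartialHomeomorph_source hY' (by simp)
  have hψs : ContDiffAt ℂ ω ψ.symm (ψ (φ 1)) := hY.to_localInverse hY' (by simp)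
  have hψc : ∀ u, ψ u = Y u := fun u => rfl
  -- Membership in the maximal atlas requires holomorphy in both directions on the whole domain, so
  -- the domain is shrunk to where `Y` and its inverse are analytic.
  obtain ⟨U, hU, hUo, hU1⟩ := eventually_nhds_iff.1 ((hY.analyticAt.eventually_analyticAt).and
    ((ψ.continuousAt hψ1).eventually hψs.analyticAt.eventually_analyticAt))
  let x := φ.trans (ψ.restrOpen U hUo)
  have hxs : ∀ v, v ∈ x.source ↔ v ∈ φ.source ∧ φ v ∈ ψ.source ∧ φ v ∈ U := fun v => by
    simp [x]
  refine ⟨x, ?_, ?_, ?_, ?_⟩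
  · refine x.mem_maximalAtlas_of_contMDiffOn ?_ ?_
    · intro v hv
      obtain ⟨hv1, hv2, hv3⟩ := (hxs v).1 hv
      exact ((hU _ hv3).1.contDiffAt.contMDiffAt.comp v
        (contMDiffAt_of_mem_maximalAtlas hφ hv1)).contMDiffWithinAt
    · intro u hu
      have hv := x.map_target hu
      obtain ⟨hv1, hv2, hv3⟩ := (hxs _).1 hv
      have h5 : ψ.symm u ∈ φ.target := hu.2
      have h2 : φ (x.symm u) = ψ.symm u := φ.right_inv h5
      have h3 : ψ (ψ.symm u) = u := by rw [← h2]; exact x.right_inv hu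
      rw [h2] at hv2 hv3
      have h4 := (hU _ hv3).2
      rw [h3] at h4
      exact ((contMDiffAt_symm_of_mem_maximalAtlas hφ h5).comp u
        h4.contDiffAt.contMDiffAt).contMDiffWithinAt
  · exact (hxs 1).2 ⟨h1, hψ1, hU1⟩
  · exact hY0
  · intro g i
    have h2 : ∀ᶠ v in 𝓝 (1 : V), x (g⁻¹ • v) = chartDeriv φ g⁻¹ (x v) := by
      filter_upwards [(φ.continuousAt h1).eventually (averagedChart_chartAction hφ h1 hG g⁻¹),
        φ.open_source.mem_nhds h1] with v hv hvs
      rw [chartAction, φ.left_inv hvs] at hv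
      exact hv
    have h3 : ((fun v => x (g⁻¹ • v) i : V → ℂ) : Germ (𝓝 (1 : V)) ℂ) =
        ∑ j, chartDeriv φ g⁻¹ (Pi.single j 1) i • coordGerm x j := by
      have h4 : ((fun v => x (g⁻¹ • v) i : V → ℂ) : Germ (𝓝 (1 : V)) ℂ) =
          ((∑ j, fun v => chartDeriv φ g⁻¹ (Pi.single j 1) i • x v j : V → ℂ) : Germ _ ℂ) := by
        refine Germ.coe_eq.2 ?_
        filter_upwards [h2] with v hv
        rw [hv, Finset.sum_apply]
        conv_lhs => rw [pi_eq_sum_univ' (x v), map_sum, Finset.sum_apply]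
        refine Finset.sum_congr rfl fun j _ => ?_
        simp [mul_comm]
      rw [h4]
      exact map_sum (Germ.coeRingHom (𝓝 (1 : V))) _ _
    rw [h3]
    exact sum_mem fun j _ => Submodule.smul_mem _ _ (Submodule.subset_span ⟨j, rfl⟩)

end Linearization

/-! ### Krull dimension and algebraic independence -/

section KrullDim

/-- Lying over lifts the first prime of a chain and going up lifts the rest. -/
theorem ringKrullDim_le_of_isIntegral_of_injective {R S : Type*} [CommRing R] [CommRing S]
    [Algebra R S] [Algebra.IsIntegral R S] (h : Function.Injective (algebraMap R S)) :
    ringKrullDim R ≤ ringKrullDim S := by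
  refine iSup_le fun l => ?_
  obtain ⟨Q, -, hQ, hQl⟩ := Ideal.exists_ideal_over_prime_of_isIntegral l.head.asIdeal (⊥ : Ideal S)
    (by
      rw [← RingHom.ker_eq_comap_bot, (RingHom.injective_iff_ker_eq_bot _).1 h]
      exact bot_le)
  have : Q.LiesOver l.head.asIdeal := ⟨hQl.symm⟩
  obtain ⟨L, hL, -⟩ := Ideal.exists_ltSeries_of_hasGoingUp l Q
  rw [← hL]
  exact le_iSup (fun L : LTSeries (PrimeSpectrum S) => (L.length : WithBot ℕ∞)) L

variable {R : Type*} [CommRing R] [Algebra ℂ R] [Algebra.FiniteType ℂ R] {t : ℕ}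

/-- Noether normalization makes `R` integral over a polynomial ring in `s` variables; `s` is the
transcendence degree, so `t ≤ s`. -/
theorem le_ringKrullDim_of_algebraicIndependent_of_isDomain [IsDomain R] {x : Fin t → R}
    (hx : AlgebraicIndependent ℂ x) : (t : WithBot ℕ∞) ≤ ringKrullDim R := by
  obtain ⟨s, g, hg, hgi⟩ := exists_integral_inj_algHom_of_fg ℂ R
  let _ := g.toRingHom.toAlgebra
  have : IsScalarTower ℂ (MvPolynomial (Fin s) ℂ) R :=
    .of_algebraMap_eq fun r => (g.commutes r).symm
  have : Algebra.IsIntegral (MvPolynomial (Fin s) ℂ) R := ⟨hgi⟩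
  have hinj : Function.Injective (algebraMap (MvPolynomial (Fin s) ℂ) R) := hg
  have : FaithfulSMul (MvPolynomial (Fin s) ℂ) R := (faithfulSMul_iff_algebraMap_injective _ _).2 hg
  have hb := (IsTranscendenceBasis.mvPolynomial (Fin s) ℂ).algebraMap_comp (A := R)
  have h1 := hb.lift_cardinalMk_eq_trdeg
  have h2 := hx.lift_cardinalMk_le_trdeg
  have hts : t ≤ s := by
    rw [← h1] at h2
    simpa using h2
  calc (t : WithBot ℕ∞) ≤ s := by exact_mod_cast hts
    _ = ringKrullDim (MvPolynomial (Fin s) ℂ) := by simp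
    _ ≤ ringKrullDim R := ringKrullDim_le_of_isIntegral_of_injective hinj

/-- Some minimal prime of `R` contracts to zero in `ℂ[x]`, and the `x i` stay independent modulo it,
which reduces the claim to a domain. -/
theorem le_ringKrullDim_of_algebraicIndependent {x : Fin t → R}
    (hx : AlgebraicIndependent ℂ x) : (t : WithBot ℕ∞) ≤ ringKrullDim R := by
  let f : MvPolynomial (Fin t) ℂ →ₐ[ℂ] R := MvPolynomial.aeval x
  have hker : (⊥ : Ideal R).comap (f : MvPolynomial (Fin t) ℂ →+* R) = ⊥ :=
    (RingHom.injective_iff_ker_eq_bot _).1 hx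
  obtain ⟨Q, hQ, hQf⟩ := Ideal.exists_minimalPrimes_comap_eq (I := ⊥)
    (f : MvPolynomial (Fin t) ℂ →+* R) ⊥ (by
      rw [hker, Ideal.minimalPrimes_eq_subsingleton_self]
      exact Set.mem_singleton _)
  have := hQ.1.1
  have hx' : AlgebraicIndependent ℂ (fun i => Ideal.Quotient.mkₐ ℂ Q (x i)) := by
    rw [algebraicIndependent_iff]
    intro P hP
    have h1 : MvPolynomial.aeval (fun i => Ideal.Quotient.mkₐ ℂ Q (x i)) P =
        Ideal.Quotient.mkₐ ℂ Q (MvPolynomial.aeval x P) :=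
      (MvPolynomial.comp_aeval_apply x (Ideal.Quotient.mkₐ ℂ Q) P).symm
    rw [h1] at hP
    have h2 : P ∈ Q.comap (f : MvPolynomial (Fin t) ℂ →+* R) :=
      Ideal.mem_comap.2 (Ideal.Quotient.eq_zero_iff_mem.1 hP)
    rwa [hQf] at h2
  exact (le_ringKrullDim_of_algebraicIndependent_of_isDomain hx').trans (ringKrullDim_quotient_le Q)

variable (R) in
theorem exists_ringKrullDim_eq_natCast [Nontrivial R] : ∃ d : ℕ, ringKrullDim R = d := by
  obtain ⟨n, f, hf⟩ := Algebra.FiniteType.iff_quotient_mvPolynomial''.1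
    (inferInstance : Algebra.FiniteType ℂ R)
  have h1 : ringKrullDim R ≤ n := by
    simpa using ringKrullDim_le_of_surjective (f : MvPolynomial (Fin n) ℂ →+* R) hf
  have h0 : 0 ≤ ringKrullDim R := ringKrullDim_nonneg_of_nontrivial
  generalize ringKrullDim R = a at h0 h1
  induction a with
  | bot => simp at h0
  | coe a =>
    have h2 : a ≤ n := by exact_mod_cast h1
    obtain ⟨d, rfl⟩ := ENat.ne_top_iff_exists.1 (ne_top_of_le_ne_top (ENat.natCast_ne_top n) h2)
    exact ⟨d, rfl⟩

end KrullDim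

/-! ### The matrix exponential, entry by entry -/

section MatrixExp

open NormedSpace

variable {m : ℕ}

open scoped Matrix.Norms.Operator in
theorem hasDerivAt_exp_smul_entry (X : Matrix (Fin m) (Fin m) ℂ) (i j : Fin m) (s : ℂ) :
    HasDerivAt (fun s : ℂ => exp (s • X) i j) ((exp (s • X) * X) i j) s :=
  (LinearMap.toContinuousLinearMap
    (Matrix.entryLinearMap ℂ ℂ i j : Matrix (Fin m) (Fin m) ℂ →ₗ[ℂ] ℂ)).hasFDerivAt.comp_hasDerivAt
      s
    (hasDerivAt_exp_smul_const X s)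

open scoped Matrix.Norms.Operator in
theorem hasStrictFDerivAt_exp_entry {t : ℕ} (T : (Fin t → ℂ) →ₗ[ℂ] Matrix (Fin m) (Fin m) ℂ)
    (i j : Fin m) : HasStrictFDerivAt (fun u => exp (T u) i j)
      (LinearMap.toContinuousLinearMap (Matrix.entryLinearMap ℂ ℂ i j ∘ₗ T)) 0 := by
  let ev := LinearMap.toContinuousLinearMap
    (Matrix.entryLinearMap ℂ ℂ i j : Matrix (Fin m) (Fin m) ℂ →ₗ[ℂ] ℂ)
  let T' := LinearMap.toContinuousLinearMap T
  have h1 : HasStrictFDerivAt (exp : Matrix (Fin m) (Fin m) ℂ → _)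
      (1 : Matrix (Fin m) (Fin m) ℂ →L[ℂ] Matrix (Fin m) (Fin m) ℂ) (T' 0) := by
    rw [map_zero]; exact hasStrictFDerivAt_exp_zero
  exact ev.hasStrictFDerivAt.comp 0 (h1.comp 0 T'.hasStrictFDerivAt)

open scoped Matrix.Norms.Operator in
theorem isInducing_entries (V : Subgroup (GL (Fin m) ℂ)) :
    Topology.IsInducing (entries : V → Fin m → Fin m → ℂ) :=
  (Units.isOpenEmbedding_val (R := Matrix (Fin m) (Fin m) ℂ)).isInducing.comp
    Topology.IsInducing.subtypeVal

end MatrixExp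

/-! ### The Lie algebra of a linear group and its exponential -/

section LieAlgebra

open MvPolynomial NormedSpace

variable {m : ℕ}

/-- A matrix as a point of affine space. -/
abbrev matrixPoint (a : Matrix (Fin m) (Fin m) ℂ) : Fin m × Fin m → ℂ := fun ij => a ij.1 ij.2

/-- The left-invariant derivation of the polynomial functions on matrices attached to `X`. -/
def invDer (X : Matrix (Fin m) (Fin m) ℂ) :
    Derivation ℂ (MvPolynomial (Fin m × Fin m) ℂ) (MvPolynomial (Fin m × Fin m) ℂ) :=
  mkDerivation ℂ fun ij => ∑ l, MvPolynomial.X (ij.1, l) * C (X l ij.2)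

theorem invDer_X (X : Matrix (Fin m) (Fin m) ℂ) (ij : Fin m × Fin m) :
    invDer X (MvPolynomial.X ij) = ∑ l, MvPolynomial.X (ij.1, l) * C (X l ij.2) :=
  mkDerivation_X _ _ _

theorem eval_invDer_X (X a : Matrix (Fin m) (Fin m) ℂ) (ij : Fin m × Fin m) :
    eval (matrixPoint a) (invDer X (MvPolynomial.X ij)) = (a * X) ij.1 ij.2 := by
  simp [invDer_X, Matrix.mul_apply]

/-- Composition of polynomial functions on matrices with left multiplication by `a`. -/
def leftMul (a : Matrix (Fin m) (Fin m) ℂ) :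
    MvPolynomial (Fin m × Fin m) ℂ →ₐ[ℂ] MvPolynomial (Fin m × Fin m) ℂ :=
  aeval fun ij => ∑ l, C (a ij.1 l) * MvPolynomial.X (l, ij.2)

theorem eval_leftMul (a b : Matrix (Fin m) (Fin m) ℂ) (p : MvPolynomial (Fin m × Fin m) ℂ) :
    eval (matrixPoint b) (leftMul a p) = eval (matrixPoint (a * b)) p := by
  induction p using MvPolynomial.induction_on with
  | C r => simp [leftMul]
  | add p q hp hq => simp only [map_add, hp, hq]
  | mul_X p ij hp =>
    rw [map_mul, map_mul, hp, map_mul]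
    congr 1
    simp [leftMul, Matrix.mul_apply]

/-- The derivation comes from right multiplication by `X`, which commutes with left multiplication
by `a`; the Leibniz rule reduces the identity to the variables. -/
theorem invDer_leftMul (X a : Matrix (Fin m) (Fin m) ℂ) (p : MvPolynomial (Fin m × Fin m) ℂ) :
    invDer X (leftMul a p) = leftMul a (invDer X p) := by
  induction p using MvPolynomial.induction_on with
  | C r =>
    rw [← algebraMap_eq, AlgHom.commutes, Derivation.map_algebraMap, map_zero]
  | add p q hp hq => simp only [map_add, hp, hq]
  | mul_X p ij hp =>
    have h1 : invDer X (leftMul a (MvPolynomial.X ij)) =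
        leftMul a (invDer X (MvPolynomial.X ij)) := by
      rw [invDer_X, leftMul, aeval_X, map_sum, map_sum]
      simp only [map_mul, ← algebraMap_eq, AlgHom.commutes, aeval_X]
      simp only [algebraMap_eq, Derivation.leibniz, derivation_C, smul_eq_mul, mul_zero, add_zero,
        invDer_X, Finset.mul_sum, Finset.sum_mul]
      rw [Finset.sum_comm]
      exact Finset.sum_congr rfl fun l _ => Finset.sum_congr rfl fun k _ => by ring
    rw [map_mul, Derivation.leibniz, Derivation.leibniz, map_add, hp, h1]
    simp only [smul_eq_mul, map_mul]

theorem hasDerivAt_eval_exp (X : Matrix (Fin m) (Fin m) ℂ) (p : MvPolynomial (Fin m × Fin m) ℂ)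
    (s : ℂ) : HasDerivAt (fun s : ℂ => eval (matrixPoint (exp (s • X))) p)
      (eval (matrixPoint (exp (s • X))) (invDer X p)) s := by
  induction p using MvPolynomial.induction_on with
  | C r =>
    rw [← algebraMap_eq, Derivation.map_algebraMap, map_zero]
    simpa using hasDerivAt_const s r
  | add p q hp hq =>
    simp only [map_add]
    exact hp.add hq
  | mul_X p ij hp =>
    have h1 : HasDerivAt (fun s : ℂ => eval (matrixPoint (exp (s • X))) (MvPolynomial.X ij))
        (eval (matrixPoint (exp (s • X))) (invDer X (MvPolynomial.X ij))) s := by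
      rw [eval_invDer_X]
      simpa only [eval_X] using hasDerivAt_exp_smul_entry X ij.1 ij.2 s
    rw [Derivation.leibniz, map_add, smul_eq_mul, smul_eq_mul, map_mul, map_mul, add_comm]
    simp only [map_mul]
    rw [mul_comm (eval _ (MvPolynomial.X ij)) (eval _ (invDer X p))]
    exact hp.mul h1

/-- The entire function `s ↦ p(exp(sX))` has `n`-th derivative `(D_X ^ n p)(1)` at `0`, so its
Taylor series vanishes; evaluate it at `s = 1`. -/
theorem eval_exp_eq_zero {X : Matrix (Fin m) (Fin m) ℂ} {p : MvPolynomial (Fin m × Fin m) ℂ}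
    (h : ∀ n : ℕ, eval (matrixPoint 1) ((invDer X)^[n] p) = 0) :
    eval (matrixPoint (exp X)) p = 0 := by
  have hder : ∀ n : ℕ, iteratedDeriv n (fun s : ℂ => eval (matrixPoint (exp (s • X))) p) =
      fun s : ℂ => eval (matrixPoint (exp (s • X))) ((invDer X)^[n] p) := by
    intro n
    induction n with
    | zero => simp
    | succ n ih =>
      rw [iteratedDeriv_succ, ih, Function.iterate_succ_apply']
      exact funext fun s => (hasDerivAt_eval_exp X _ s).deriv
  have h1 := Complex.taylorSeries_eq_of_entire' 0 1
    (f := fun s : ℂ => eval (matrixPoint (exp (s • X))) p)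
    fun s => (hasDerivAt_eval_exp X p s).differentiableAt
  simp only [hder, zero_smul, exp_zero, h, mul_zero, zero_mul, tsum_zero, one_smul] at h1
  exact h1.symm

variable (V : Subgroup (GL (Fin m) ℂ))

/-- The polynomial functions on matrices that vanish on `V`. -/
def vanishingPolys : Submodule ℂ (MvPolynomial (Fin m × Fin m) ℂ) where
  carrier := {p | ∀ v ∈ V, eval (matrixPoint (v : Matrix (Fin m) (Fin m) ℂ)) p = 0}
  zero_mem' := fun _ _ => map_zero _
  add_mem' := fun hp hq v hv => by rw [map_add, hp v hv, hq v hv, add_zero]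
  smul_mem' := fun r p hp v hv => by rw [smul_eval, hp v hv, mul_zero]

theorem invDer_add (X Y : Matrix (Fin m) (Fin m) ℂ) : invDer (X + Y) = invDer X + invDer Y :=
  derivation_ext fun ij => by
    simp [invDer_X, mul_add, Finset.sum_add_distrib]

theorem invDer_smul (r : ℂ) (X : Matrix (Fin m) (Fin m) ℂ) : invDer (r • X) = r • invDer X :=
  derivation_ext fun ij => by
    simp only [invDer_X, Derivation.smul_apply, Finset.smul_sum, Matrix.smul_apply, smul_eq_mul,
      C_mul, smul_eq_C_mul]
    exact Finset.sum_congr rfl fun l _ => by ring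

/-- The differential at the identity matrix. -/
def tangentForm : MvPolynomial (Fin m × Fin m) ℂ →ₗ[ℂ] Module.Dual ℂ (Matrix (Fin m) (Fin m) ℂ) :=
  LinearMap.mk₂ ℂ (fun p X => eval (matrixPoint 1) (invDer X p))
    (fun p q X => by simp) (fun r p X => by simp)
    (fun p X Y => by simp [invDer_add]) (fun r p X => by simp [invDer_smul])

theorem tangentForm_apply (p : MvPolynomial (Fin m × Fin m) ℂ) (X : Matrix (Fin m) (Fin m) ℂ) :
    tangentForm p X = eval (matrixPoint 1) (invDer X p) := rfl

/-- The Lie algebra of `V`: the common kernel of the differentials at the identity of the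
polynomials that vanish on `V`. -/
def lieAlgebra : Submodule ℂ (Matrix (Fin m) (Fin m) ℂ) :=
  ((vanishingPolys V).map tangentForm).dualCoannihilator

variable {V}

theorem mem_lieAlgebra_iff {X : Matrix (Fin m) (Fin m) ℂ} :
    X ∈ lieAlgebra V ↔ ∀ p ∈ vanishingPolys V, eval (matrixPoint 1) (invDer X p) = 0 := by
  simp [lieAlgebra, Submodule.mem_dualCoannihilator, tangentForm_apply]

/-- Finite-dimensional double annihilator: the differentials of vanishing polynomials already form a
subspace of the dual. -/
theorem exists_tangentForm_eq {f : Module.Dual ℂ (Matrix (Fin m) (Fin m) ℂ)}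
    (hf : ∀ X ∈ lieAlgebra V, f X = 0) : ∃ p ∈ vanishingPolys V, tangentForm p = f := by
  have : f ∈ (lieAlgebra V).dualAnnihilator := (Submodule.mem_dualAnnihilator f).2 hf
  rw [lieAlgebra, Subspace.dualCoannihilator_dualAnnihilator_eq] at this
  exact this

/-- By left invariance, the value of `invDer X p` at `v` is the value at `1` of the derivative of
the translate of `p` by `v`, which still vanishes on `V`. -/
theorem invDer_mem_vanishingPolys {X : Matrix (Fin m) (Fin m) ℂ} (hX : X ∈ lieAlgebra V)
    {p : MvPolynomial (Fin m × Fin m) ℂ} (hp : p ∈ vanishingPolys V) :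
    invDer X p ∈ vanishingPolys V := by
  intro v hv
  have h1 : leftMul (v : Matrix (Fin m) (Fin m) ℂ) p ∈ vanishingPolys V := fun w hw => by
    rw [eval_leftMul]
    exact hp (v * w) (mul_mem hv hw)
  have h2 := mem_lieAlgebra_iff.1 hX _ h1
  rwa [invDer_leftMul, eval_leftMul, mul_one] at h2

theorem eval_exp_of_mem_vanishingPolys {X : Matrix (Fin m) (Fin m) ℂ} (hX : X ∈ lieAlgebra V)
    {p : MvPolynomial (Fin m × Fin m) ℂ} (hp : p ∈ vanishingPolys V) :
    eval (matrixPoint (exp X)) p = 0 := by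
  refine eval_exp_eq_zero fun n => ?_
  have : (invDer X)^[n] p ∈ vanishingPolys V := by
    induction n with
    | zero => exact hp
    | succ n ih =>
      rw [Function.iterate_succ_apply']
      exact invDer_mem_vanishingPolys hX ih
  exact this 1 (one_mem V)

theorem exists_mem_coe_eq_exp (hV : IsLinearAlgebraicGroup V) {X : Matrix (Fin m) (Fin m) ℂ}
    (hX : X ∈ lieAlgebra V) :
    ∃ v : V, ((v : GL (Fin m) ℂ) : Matrix (Fin m) (Fin m) ℂ) = exp X := by
  obtain ⟨S, hS⟩ := hV
  obtain ⟨g, hg⟩ := Matrix.isUnit_exp X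
  refine ⟨⟨g, (hS g).2 fun p hp => ?_⟩, hg⟩
  have := eval_exp_of_mem_vanishingPolys hX (V := V) (p := p) fun v hv => (hS v).1 hv p hp
  rwa [← hg] at this

end LieAlgebra

/-! ### The local ring of a linear algebraic group at the identity -/

section Regular

open MvPolynomial

variable {m : ℕ} (V : Subgroup (GL (Fin m) ℂ))

theorem pure_one_le_zariskiNhds : pure 1 ≤ zariskiNhds V :=
  @pure_le_nhds V (zariskiTopology V) 1

theorem eventually_ne_zero {q : V → ℂ} (hq : q ∈ regularFunctions V) (h1 : q 1 ≠ 0) :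
    ∀ᶠ v in zariskiNhds V, q v ≠ 0 :=
  (@mem_nhds_iff V (zariskiTopology V) 1 _).2 ⟨_, subset_rfl,
    TopologicalSpace.isOpen_generateFrom_of_mem ⟨q, hq, rfl⟩, h1⟩

/-- The germ at the identity of a regular function. -/
def regGerm : regularFunctions V →ₐ[ℂ] regGerms V where
  toFun p := ⟨((p : V → ℂ) : Germ (zariskiNhds V) ℂ), p, p.2, 1, one_mem _, one_ne_zero, by simp⟩
  map_one' := rfl
  map_mul' _ _ := rfl
  map_zero' := rfl
  map_add' _ _ := rfl
  commutes' r := Subtype.ext (algebraMap_germ _ r).symm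

theorem regGerm_mul_inv_eq_one {q : V → ℂ} (hq : q ∈ regularFunctions V) (h1 : q 1 ≠ 0) :
    regGerm V ⟨q, hq⟩ * ⟨((fun v => 1 / q v : V → ℂ) : Germ (zariskiNhds V) ℂ), 1, one_mem _, q, hq,
      h1, rfl⟩ = 1 := by
  refine Subtype.ext (Germ.coe_eq.2 ?_)
  filter_upwards [eventually_ne_zero V hq h1] with v hv
  simp [hv]

/-- The matrix entries as regular functions. -/
def entryFun (ij : Fin m × Fin m) : regularFunctions V :=
  ⟨fun v => entries v ij.1 ij.2, Algebra.subset_adjoin (Or.inl ⟨ij.1, ij.2, rfl⟩)⟩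

/-- The functions attached to linear forms on matrices, normalized to vanish at the identity. -/
def linFun : Module.Dual ℂ (Matrix (Fin m) (Fin m) ℂ) →ₗ[ℂ] regularFunctions V where
  toFun f := ∑ ij : Fin m × Fin m, f (Matrix.single ij.1 ij.2 1) •
    (entryFun V ij - algebraMap ℂ _ ((1 : Matrix (Fin m) (Fin m) ℂ) ij.1 ij.2))
  map_add' f g := by simp only [LinearMap.add_apply, add_smul, Finset.sum_add_distrib]
  map_smul' r f := by
    simp only [LinearMap.smul_apply, Finset.smul_sum, smul_smul, RingHom.id_apply, smul_eq_mul]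

/-- Evaluation of regular functions. -/
def evalRegular (v : V) : regularFunctions V →ₐ[ℂ] ℂ :=
  (Pi.evalAlgHom ℂ (fun _ : V => ℂ) v).comp (regularFunctions V).val

theorem evalRegular_apply (v : V) (p : regularFunctions V) :
    evalRegular V v p = (p : V → ℂ) v := rfl

theorem linFun_apply (f : Module.Dual ℂ (Matrix (Fin m) (Fin m) ℂ)) (v : V) :
    (linFun V f : V → ℂ) v = f (((v : GL (Fin m) ℂ) : Matrix (Fin m) (Fin m) ℂ) - 1) := by
  conv_rhs => rw [Matrix.matrix_eq_sum_single (((v : GL (Fin m) ℂ) : Matrix (Fin m) (Fin m) ℂ) - 1)]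
  rw [← evalRegular_apply]
  simp only [linFun, LinearMap.coe_mk, AddHom.coe_mk, map_sum, Fintype.sum_prod_type, map_smul,
    map_sub, AlgHom.commutes]
  refine Finset.sum_congr rfl fun i _ => Finset.sum_congr rfl fun j _ => ?_
  generalize hx : (((v : GL (Fin m) ℂ) : Matrix (Fin m) (Fin m) ℂ) - 1) i j = x
  rw [← mul_one x, ← smul_eq_mul x, ← Matrix.smul_single, map_smul, ← hx, smul_eq_mul, mul_comm]
  rfl

/-- The augmentation of the local ring at the identity. -/
abbrev regAug : regGerms V →ₐ[ℂ] ℂ := germAug (regGerms V) (pure_one_le_zariskiNhds V)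

theorem regAug_regGerm (p : regularFunctions V) : regAug V (regGerm V p) = (p : V → ℂ) 1 := rfl

theorem regAug_linFun (f : Module.Dual ℂ (Matrix (Fin m) (Fin m) ℂ)) :
    regAug V (regGerm V (linFun V f)) = 0 := by
  rw [regAug_regGerm, linFun_apply]
  simp

/-- The coordinate forms on matrices. -/
abbrev entryForm (ij : Fin m × Fin m) : Module.Dual ℂ (Matrix (Fin m) (Fin m) ℂ) :=
  Matrix.entryLinearMap ℂ ℂ ij.1 ij.2

theorem regGerm_entryFun_eq (ij : Fin m × Fin m) :
    regGerm V (entryFun V ij) = regGerm V (linFun V (entryForm ij)) +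
      algebraMap ℂ _ ((1 : Matrix (Fin m) (Fin m) ℂ) ij.1 ij.2) := by
  rw [← AlgHom.commutes (regGerm V), ← map_add]
  congr 1
  refine Subtype.ext (funext fun v => ?_)
  change _ = (linFun V (entryForm ij) : V → ℂ) v + (1 : Matrix (Fin m) (Fin m) ℂ) ij.1 ij.2
  rw [linFun_apply]
  simp [entryFun, entries]

/-- The germs congruent to constants modulo the span contain the matrix entries, hence the
determinant, its inverse, all regular functions and finally all fractions. -/
theorem augIdeal_regAug_le :
    augIdeal (regAug V) ≤ Ideal.span (Set.range fun ij => regGerm V (linFun V (entryForm ij))) := by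
  set I := Ideal.span (Set.range fun ij => regGerm V (linFun V (entryForm ij)))
  set B := constSubalgebra (regAug V) I
  refine augIdeal_le_of_constSubalgebra_eq_top (top_unique ?_)
  have hentry : ∀ ij, regGerm V (entryFun V ij) ∈ B := fun ij => by
    rw [regGerm_entryFun_eq]
    refine add_mem ?_ (algebraMap_mem _ _)
    rw [mem_constSubalgebra, regAug_linFun, map_zero, sub_zero]
    exact Ideal.subset_span ⟨ij, rfl⟩
  have hreg : ∀ f (hf : f ∈ regularFunctions V), regGerm V ⟨f, hf⟩ ∈ B := by
    have h1 : regularFunctions V ≤ (B.comap (regGerm V)).map (regularFunctions V).val := by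
      refine Algebra.adjoin_le ?_
      rintro f (⟨i, j, rfl⟩ | rfl)
      · exact ⟨entryFun V (i, j), hentry (i, j), rfl⟩
      · let d : regularFunctions V := ∑ σ : Equiv.Perm (Fin m),
          ((Equiv.Perm.sign σ : ℤ) : ℂ) • ∏ i, entryFun V (σ i, i)
        have hd : ∀ v, (d : V → ℂ) v = ((v : GL (Fin m) ℂ) : Matrix (Fin m) (Fin m) ℂ).det := by
          intro v
          rw [Matrix.det_apply']
          simp [d, entryFun, entries]
        have hdB : regGerm V d ∈ B := by
          simp only [d, map_sum, map_smul, map_prod]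
          exact sum_mem fun σ _ => B.smul_mem (prod_mem fun i _ => hentry _) _
        refine ⟨⟨_, Algebra.subset_adjoin (Or.inr rfl)⟩,
          mem_constSubalgebra_of_mul_eq_one ?_ hdB, rfl⟩
        rw [RingHom.coe_coe, ← map_mul, ← map_one (regGerm V)]
        congr 1
        refine Subtype.ext (funext fun v => ?_)
        change (d : V → ℂ) v * (((v : GL (Fin m) ℂ) : Matrix (Fin m) (Fin m) ℂ).det)⁻¹ = 1
        rw [hd]
        exact mul_inv_cancel₀ ((Matrix.isUnit_iff_isUnit_det _).1 (v : GL (Fin m) ℂ).isUnit).ne_zero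
    intro f hf
    obtain ⟨b, hb, rfl⟩ := h1 hf
    exact hb
  rintro ⟨_, p, hp, q, hq, h1, rfl⟩ -
  have h2 := mul_mem (hreg p hp)
    (mem_constSubalgebra_of_mul_eq_one (regGerm_mul_inv_eq_one V hq h1) (hreg q hq))
  convert h2 using 1
  refine Subtype.ext (congrArg (fun F : V → ℂ => (F : Germ (zariskiNhds V) ℂ)) (funext fun v => ?_))
  simp [div_eq_mul_inv]

theorem fg_augIdeal_regAug : (augIdeal (regAug V)).FG := by
  have : augIdeal (regAug V) =
      Ideal.span (Set.range fun ij => regGerm V (linFun V (entryForm ij))) := by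
    refine le_antisymm (augIdeal_regAug_le V) (Ideal.span_le.2 ?_)
    rintro _ ⟨ij, rfl⟩
    exact regAug_linFun V _
  exact this ▸ Submodule.fg_span (Set.finite_range _)

/-- The first-order Taylor expansion at the identity, proved by induction on `p` with the product
rule. -/
theorem aeval_entryFun_sub_mem (p : MvPolynomial (Fin m × Fin m) ℂ) :
    regGerm V (aeval (entryFun V) p) - algebraMap ℂ _ (eval (matrixPoint 1) p) -
      regGerm V (linFun V (tangentForm p)) ∈ augIdeal (regAug V) ^ 2 := by
  have hmem : ∀ f, regGerm V (linFun V f) ∈ augIdeal (regAug V) := regAug_linFun V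
  induction p using MvPolynomial.induction_on with
  | C r =>
    have h1 : tangentForm (C r : MvPolynomial (Fin m × Fin m) ℂ) = 0 := by
      ext1 X
      rw [tangentForm_apply, ← algebraMap_eq, Derivation.map_algebraMap, map_zero]
      rfl
    rw [h1, map_zero, map_zero, aeval_C, eval_C, AlgHom.commutes]
    simp
  | add p q hp hq =>
    have := add_mem hp hq
    simp only [map_add]
    convert this using 1
    ring
  | mul_X p ij hp =>
    have h1 : tangentForm (p * MvPolynomial.X ij) = eval (matrixPoint 1) p • entryForm ij +
        (1 : Matrix (Fin m) (Fin m) ℂ) ij.1 ij.2 • tangentForm p := by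
      refine LinearMap.ext fun X => ?_
      rw [tangentForm_apply, Derivation.leibniz, map_add, smul_eq_mul, smul_eq_mul, map_mul,
        map_mul, eval_invDer_X, one_mul, eval_X]
      rfl
    rw [h1, map_add, map_add, map_smul, map_smul, map_smul, map_smul, map_mul, map_mul, map_mul,
      map_mul, aeval_X, eval_X, regGerm_entryFun_eq]
    simp only [Algebra.smul_def]
    set Y := regGerm V (linFun V (entryForm ij))
    set D := regGerm V (linFun V (tangentForm p))
    set a := regGerm V (aeval (entryFun V) p)
    set c := algebraMap ℂ (regGerms V) (eval (matrixPoint 1) p)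
    set δ := algebraMap ℂ (regGerms V) ((1 : Matrix (Fin m) (Fin m) ℂ) ij.1 ij.2)
    have h2 : a * (Y + δ) - c * δ - (c * Y + δ * D) = (a - c - D) * (Y + δ) + D * Y := by ring
    rw [h2]
    refine add_mem (Ideal.mul_mem_right _ _ hp) ?_
    rw [pow_two]
    exact Ideal.mul_mem_mul (hmem _) (hmem _)

/-- Such an `f` is the differential of a polynomial vanishing on `V`; in the Taylor expansion of
that zero germ only the linear term remains. -/
theorem regGerm_linFun_mem_sq {f : Module.Dual ℂ (Matrix (Fin m) (Fin m) ℂ)}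
    (hf : ∀ X ∈ lieAlgebra V, f X = 0) : regGerm V (linFun V f) ∈ augIdeal (regAug V) ^ 2 := by
  obtain ⟨p, hp, rfl⟩ := exists_tangentForm_eq hf
  have h1 := aeval_entryFun_sub_mem V p
  have h2 : aeval (entryFun V) p = 0 := by
    refine Subtype.ext (funext fun v => ?_)
    refine Eq.trans ?_ (hp v v.2)
    rw [← evalRegular_apply, comp_aeval_apply]
    rfl
  have h3 : eval (matrixPoint 1) p = 0 := hp 1 (one_mem V)
  rw [h2, h3, map_zero, map_zero, sub_zero, zero_sub] at h1
  simpa using neg_mem h1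

end Regular

/-! ### Linear algebraic groups: parametrization and conclusion -/

section LinearGroup

open Asymptotics NormedSpace

variable {m : ℕ} {V : Subgroup (GL (Fin m) ℂ)}

/-- A local parametrization of a linear algebraic group by its Lie algebra, whose inverse is given
by linear functions of the matrix entries. -/
theorem exists_parametrization (hV : IsLinearAlgebraicGroup V) :
    ∃ (t : ℕ) (ξ : Fin t → Module.Dual ℂ (Matrix (Fin m) (Fin m) ℂ)) (E : (Fin t → ℂ) → V),
      (∀ f : Module.Dual ℂ (Matrix (Fin m) (Fin m) ℂ), ∃ c : Fin t → ℂ,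
        ∀ X ∈ lieAlgebra V, (f - ∑ k, c k • ξ k) X = 0) ∧
      E 0 = 1 ∧ DifferentiableAt ℂ (fun u => entries (E u)) 0 ∧
      ∀ᶠ u in 𝓝 0, ∀ k, ξ k (((E u : GL (Fin m) ℂ) : Matrix (Fin m) (Fin m) ℂ) - 1) = u k := by
  let b := Module.finBasis ℂ (lieAlgebra V)
  set t := Module.finrank ℂ (lieAlgebra V)
  let T : (Fin t → ℂ) →ₗ[ℂ] Matrix (Fin m) (Fin m) ℂ :=
    (lieAlgebra V).subtype ∘ₗ b.equivFun.symm.toLinearMap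
  have hT : LinearMap.ker T = ⊥ := by
    rw [LinearMap.ker_eq_bot]
    exact (Submodule.subtype_injective _).comp b.equivFun.symm.injective
  obtain ⟨Ξ, hΞ⟩ := T.exists_leftInverse_of_injective hT
  have hΞT : ∀ u, Ξ (T u) = u := fun u => LinearMap.congr_fun hΞ u
  have hTmem : ∀ u, T u ∈ lieAlgebra V := fun u => (b.equivFun.symm u).2
  choose E hE using fun u => exists_mem_coe_eq_exp hV (hTmem u)
  -- The linear coordinates of the exponential have derivative `Ξ ∘ T = 1` at `0`; composing `E`
  -- with the local inverse of `ψ` makes them exactly `u`.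
  let ψ : (Fin t → ℂ) → (Fin t → ℂ) := fun u => Ξ (exp (T u) - 1)
  let T' : (Fin t → ℂ) →L[ℂ] (Fin m → Fin m → ℂ) := ContinuousLinearMap.pi fun i =>
    ContinuousLinearMap.pi fun j => LinearMap.toContinuousLinearMap
      (Matrix.entryLinearMap ℂ ℂ i j ∘ₗ T)
  let Ξ' : (Fin m → Fin m → ℂ) →ₗ[ℂ] (Fin t → ℂ) := Ξ ∘ₗ (Matrix.ofLinearEquiv ℂ).toLinearMap
  have hent : HasStrictFDerivAt (fun u => entries (E u)) T' 0 := by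
    refine hasStrictFDerivAt_pi'.2 fun i => hasStrictFDerivAt_pi'.2 fun j => ?_
    have h1 := hasStrictFDerivAt_exp_entry T i j
    simp only [← hE] at h1
    exact h1
  have hψ : HasStrictFDerivAt ψ ((ContinuousLinearEquiv.refl ℂ (Fin t → ℂ) :
      (Fin t → ℂ) →L[ℂ] (Fin t → ℂ))) 0 := by
    have h1 := (LinearMap.toContinuousLinearMap Ξ').hasStrictFDerivAt
      (x := entries (E 0) - fun i j => (1 : Matrix (Fin m) (Fin m) ℂ) i j)
    have h2 := h1.comp 0 (hent.sub_const _)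
    have h3 : (LinearMap.toContinuousLinearMap Ξ').comp T' = ContinuousLinearMap.id ℂ _ :=
      ContinuousLinearMap.ext hΞT
    rw [h3] at h2
    have h4 : ψ = (LinearMap.toContinuousLinearMap Ξ') ∘ fun u => entries (E u) -
        fun i j => (1 : Matrix (Fin m) (Fin m) ℂ) i j := by
      funext u
      change Ξ _ = Ξ (((E u : GL (Fin m) ℂ) : Matrix (Fin m) (Fin m) ℂ) - 1)
      rw [hE]
    rw [h4]
    exact h2
  have hψ0 : ψ 0 = 0 := by simp [ψ]
  let σ := hψ.localInverse ψ _ 0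
  have hσ : HasStrictFDerivAt σ _ (ψ 0) := hψ.to_localInverse
  have hσ0 : σ 0 = 0 := by
    have := hψ.localInverse_apply_image
    rwa [hψ0] at this
  rw [hψ0] at hσ
  -- On the Lie algebra the forms `ξ k` are dual to the basis `T (Pi.single k 1)`, so the
  -- coefficients of `f` are its values on that basis.
  refine ⟨t, fun k => LinearMap.proj k ∘ₗ Ξ, E ∘ σ, fun f => ⟨fun k => f (T (Pi.single k 1)), ?_⟩,
    ?_, ?_, ?_⟩
  · intro X hX
    obtain ⟨u, rfl⟩ : ∃ u, T u = X := ⟨b.equivFun ⟨X, hX⟩, by simp [T]⟩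
    simp only [LinearMap.sub_apply, LinearMap.sum_apply, LinearMap.smul_apply, LinearMap.comp_apply,
      hΞT, LinearMap.proj_apply, smul_eq_mul]
    rw [sub_eq_zero]
    refine ((congrArg (fun u => f (T u)) (pi_eq_sum_univ' u))).trans ?_
    simp [mul_comm]
  · refine Subtype.ext (Units.ext ?_)
    change (((E (σ 0) : V) : GL (Fin m) ℂ) : Matrix (Fin m) (Fin m) ℂ) = 1
    rw [hE, hσ0, map_zero, exp_zero]
  · have h1 : DifferentiableAt ℂ (fun u => entries (E u)) (σ 0) := by
      rw [hσ0]; exact hent.hasFDerivAt.differentiableAt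
    exact h1.comp 0 hσ.hasFDerivAt.differentiableAt
  · have h1 := hψ.eventually_right_inverse
    rw [hψ0] at h1
    filter_upwards [h1] with u hu k
    change Ξ (((E (σ u) : GL (Fin m) ℂ) : Matrix (Fin m) (Fin m) ℂ) - 1) k = u k
    rw [hE]
    exact congrFun hu k

theorem continuous_smul_of_regular {G : Type*} [Group G] [MulDistribMulAction G V]
    (hG : ∀ g : G, ∀ f ∈ regularFunctions V, (fun v => f (g • v)) ∈ regularFunctions V) (g : G) :
    Continuous fun v : V => g • v :=
  (isInducing_entries V).continuous_iff.2 <| continuous_pi fun i => continuous_pi fun j =>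
    continuous_of_mem_regularFunctions (hG g _ (entryFun V (i, j)).2)

theorem tendsto_smul_zariskiNhds {G : Type*} [Group G] [MulDistribMulAction G V]
    (hG : ∀ g : G, ∀ f ∈ regularFunctions V, (fun v => f (g • v)) ∈ regularFunctions V) (g : G) :
    Tendsto (fun v : V => g • v) (zariskiNhds V) (zariskiNhds V) := by
  let _ := zariskiTopology V
  have h1 : Continuous fun v : V => g • v := continuous_generateFrom_iff.2 (by
    rintro _ ⟨q, hq, rfl⟩
    exact TopologicalSpace.isOpen_generateFrom_of_mem ⟨_, hG g q hq, rfl⟩)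
  have h2 := h1.tendsto 1
  rwa [smul_one] at h2

theorem finiteType_regularFunctions (V : Subgroup (GL (Fin m) ℂ)) :
    Algebra.FiniteType ℂ (regularFunctions V) := by
  refine (Subalgebra.fg_iff_finiteType _).1 (Subalgebra.fg_def.2 ⟨_, ?_, rfl⟩)
  refine Set.Finite.union ?_ (Set.finite_singleton _)
  refine (Set.finite_range fun ij : Fin m × Fin m => fun v : V => entries v ij.1 ij.2).subset ?_
  rintro _ ⟨i, j, rfl⟩
  exact ⟨(i, j), rfl⟩

/-- A relation among the `x k`, evaluated along `E`, is a polynomial vanishing near `0`; it lies in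
every power of the ideal of the variables, hence is zero. -/
theorem algebraicIndependent_of_parametrization {t : ℕ} {x : Fin t → regularFunctions V}
    {E : (Fin t → ℂ) → V} (h : ∀ᶠ u in 𝓝 0, ∀ k, (x k : V → ℂ) (E u) = u k) :
    AlgebraicIndependent ℂ x := by
  rw [algebraicIndependent_iff]
  intro P hP
  have h1 : ∀ᶠ u in 𝓝 0, MvPolynomial.eval u P = 0 := by
    filter_upwards [h] with u hu
    have h2 := congrArg (evalRegular V (E u)) hP
    rw [MvPolynomial.comp_aeval_apply, map_zero] at h2
    simp only [evalRegular_apply, hu] at h2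
    exact h2
  have h2 : ∀ k, P ∈ MvPolynomial.idealOfVars (Fin t) ℂ ^ k := fun k =>
    mem_pow_idealOfVars_of_isBigO
      ((isBigO_zero _ _).congr' (h1.mono fun _ hu => hu.symm) EventuallyEq.rfl)
  ext d
  exact (MvPolynomial.mem_pow_idealOfVars_iff' _ _).1 (h2 (d.degree + 1)) d (Nat.lt_succ_self _)

/-- The comparison gives the bound `|G| ^ t` with `t` from the parametrization, and algebraic
independence of the coordinates gives `t ≤ d`. -/
theorem coinvariantMap_bijective_and_finrank_le_of_linear {G : Type*} [Group G] [Finite G]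
    [MulDistribMulAction G V] (hV : IsLinearAlgebraicGroup V)
    (hG : ∀ g : G, ∀ f ∈ regularFunctions V, (fun v => f (g • v)) ∈ regularFunctions V) :
    Function.Bijective
        (coinvariantMap G (nhds_le_zariskiNhds V) (regGerms V) (holGermsLinear V)
          (regGerms_le_holGermsLinear V)) ∧
      Module.Finite ℂ (CoinvariantSpace G (holGermsLinear V)) ∧
      ∃ d : ℕ, ringKrullDim (regularFunctions V) = d ∧
        Module.finrank ℂ (CoinvariantSpace G (holGermsLinear V)) ≤ Nat.card G ^ d := by
  obtain ⟨t, ξ, E, hξ, hE1, hEd, hEξ⟩ := exists_parametrization hV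
  have hl := tendsto_smul_zariskiNhds hG
  have hl' : ∀ g : G, Tendsto (fun v : V => g • v) (𝓝 1) (𝓝 1) := fun g => by
    simpa using (continuous_smul_of_regular hG g).tendsto 1
  have hE : Tendsto E (𝓝 0) (𝓝 1) := by
    have h1 := hEd.continuousAt
    rw [ContinuousAt, hE1] at h1
    exact (isInducing_entries V).tendsto_nhds_iff.2 h1
  have hEx : ∀ᶠ u in 𝓝 0, ∀ k, (linFun V (ξ k) : V → ℂ) (E u) = u k := by
    simpa only [linFun_apply] using hEξ
  have hEC : ∀ f ∈ augIdeal (germAug (holGermsLinear V) (pure_le_nhds 1)), ∃ F : V → ℂ,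
      (F : Germ (𝓝 (1 : V)) ℂ) = f ∧ (fun u => F (E u)) =O[𝓝 0] fun u => ‖u‖ := by
    rintro ⟨_, F, hF, rfl⟩ h0
    refine ⟨_, rfl, ?_⟩
    have h1 : DifferentiableAt ℂ (fun u => F (entries (E u))) 0 :=
      DifferentiableAt.comp (g := F) 0 (by rw [hE1]; exact hF.differentiableAt) hEd
    replace h0 : F (entries (1 : V)) = 0 := h0
    simpa [hE1, h0] using h1.isBigO_sub.norm_right
  -- Each entry form differs from a combination of the `ξ k` by a form that kills the Lie algebra,
  -- whose germ lies in the square.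
  have hgen : augIdeal (regAug V) ≤
      Ideal.span (Set.range fun k => regGerm V (linFun V (ξ k))) ⊔ augIdeal (regAug V) ^ 2 := by
    refine (augIdeal_regAug_le V).trans (Ideal.span_le.2 ?_)
    rintro _ ⟨ij, rfl⟩
    obtain ⟨c, hc⟩ := hξ (entryForm ij)
    have h1 := regGerm_linFun_mem_sq V hc
    rw [map_sub, map_sub, map_sum, map_sum] at h1
    simp only [map_smul] at h1
    change regGerm V (linFun V (entryForm ij)) ∈ _
    rw [← add_sub_cancel (∑ k, c k • regGerm V (linFun V (ξ k)))
      (regGerm V (linFun V (entryForm ij)))]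
    refine Submodule.add_mem_sup (sum_mem fun k _ => ?_) h1
    rw [Algebra.smul_def]
    exact Ideal.mul_mem_left _ _ (Ideal.subset_span ⟨k, rfl⟩)
  have hmap : augIdeal (germAug (holGermsLinear V) (pure_le_nhds 1)) ≤ (augIdeal (regAug V)).map
      (restrictHom (nhds_le_zariskiNhds V) (regGerms V) (holGermsLinear V)
        (regGerms_le_holGermsLinear V)) := by
    rintro ⟨f, F, hF, rfl⟩ hf0
    replace hf0 : F (entries (1 : V)) = 0 := hf0
    obtain ⟨S, hS, hFS⟩ := exists_analyticAt_eq_add_apply hF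
    let c : Fin m × Fin m → holGermsLinear V := fun ij => ⟨_,
      fun z => S z (Matrix.single ij.1 ij.2 1),
      (ContinuousLinearMap.apply (E := Fin m → Fin m → ℂ) ℂ ℂ
        (Matrix.single ij.1 ij.2 1)).analyticAt _ |>.comp hS, rfl⟩
    have hsum : (⟨((fun v => F (entries v) : V → ℂ) : Germ (𝓝 (1 : V)) ℂ), F, hF, rfl⟩ :
        holGermsLinear V) = ∑ ij, restrictHom (nhds_le_zariskiNhds V) (regGerms V)
          (holGermsLinear V) (regGerms_le_holGermsLinear V)
            (regGerm V (linFun V (entryForm ij))) * c ij := by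
      refine Subtype.ext ?_
      rw [AddSubmonoidClass.coe_finsetSum]
      have h2 : ((fun v => F (entries v) : V → ℂ) : Germ (𝓝 (1 : V)) ℂ) =
          ((∑ ij, (linFun V (entryForm ij) : V → ℂ) *
            fun v => S (entries v) (Matrix.single ij.1 ij.2 1) : V → ℂ) : Germ _ ℂ) := by
        refine Germ.coe_eq.2 ?_
        filter_upwards [(isInducing_entries V).continuous.continuousAt.eventually hFS] with v hv
        rw [hf0, zero_add] at hv
        rw [hv, Finset.sum_apply]
        refine ((congrArg (S (entries v)) (Matrix.matrix_eq_sum_single (α := ℂ)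
          (entries v - entries (1 : V)))).trans (map_sum _ _ _)).trans ?_
        rw [Fintype.sum_prod_type]
        refine Finset.sum_congr rfl fun i _ => (map_sum _ _ _).trans
          (Finset.sum_congr rfl fun j _ => ?_)
        generalize hx : (entries v - entries (1 : V)) i j = x
        have h3 : (linFun V (entryForm (i, j)) : V → ℂ) v = x := by
          rw [linFun_apply]; exact hx
        have h4 : (Matrix.single i j x : Fin m → Fin m → ℂ) = x • Matrix.single i j (1 : ℂ) := by
          rw [Matrix.smul_single, smul_eq_mul, mul_one]
        rw [Pi.mul_apply, h3]
        exact (congrArg (S (entries v)) h4).trans ((S (entries v)).map_smul x _)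
      exact h2.trans (map_sum (Germ.coeRingHom (𝓝 (1 : V))) _ _)
    rw [hsum]
    exact sum_mem fun ij _ => Ideal.mul_mem_right _ _
      (Ideal.mem_map_of_mem _ (regAug_linFun V _))
  obtain ⟨hbij, hfin, hrank⟩ := coinvariantMap_bijective_and_finrank_le (nhds_le_zariskiNhds V)
    (regGerms V) (holGermsLinear V) (regGerms_le_holGermsLinear V) (pure_le_nhds 1) hl hl'
    (by
      rintro g _ ⟨p, hp, q, hq, h1, rfl⟩
      exact ⟨_, hG g⁻¹ p hp, _, hG g⁻¹ q hq, by simpa using h1, rfl⟩)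
    (by
      rintro g _ ⟨F, hF, rfl⟩
      -- The action need not extend to matrices as a group action, but the entries of `g⁻¹ • v` are
      -- regular, hence restrictions of functions `R i j` analytic near the identity; `F` is
      -- composed with these.
      choose R hR hRe using fun i j => regularFunctions_germ_mem V (hG g⁻¹ _ (entryFun V (i, j)).2)
      have h1 : ∀ v : V, (fun i j => R i j (entries v)) = entries (g⁻¹ • v) := fun v =>
        funext fun i => funext fun j => hRe i j v
      refine ⟨fun z => F (fun i j => R i j z), ?_, ?_⟩
      · refine AnalyticAt.comp (g := F) ?_ (analyticAt_pi_iff.2 fun i =>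
          analyticAt_pi_iff.2 fun j => hR i j)
        rw [h1, smul_one]
        exact hF
      · simp only [h1]
        rfl)
    (fun k => regGerm V (linFun V (ξ k))) (fun k => regAug_linFun V (ξ k))
    (fg_augIdeal_regAug V) hgen hmap E hE (fun k => linFun V (ξ k)) (fun k => rfl) hEx hEC
  have := finiteType_regularFunctions V
  obtain ⟨d, hd⟩ := exists_ringKrullDim_eq_natCast (regularFunctions V)
  have htd : t ≤ d := by
    have h1 := le_ringKrullDim_of_algebraicIndependent (algebraicIndependent_of_parametrization hEx)
    rw [hd] at h1
    exact_mod_cast h1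
  exact ⟨hbij, hfin, d, hd, hrank.trans (Nat.pow_le_pow_right Nat.card_pos htd)⟩

end LinearGroup

end Coinvariants

end

open Coinvariants in
theorem mainTheorem4 (G : Type*) [Group G] [Finite G] :
    -- complex Lie groups; `(𝒪_A)_e` consists of the germs of polynomials in linearizing coordinates
    (∀ (n : ℕ) (V : Type*) [TopologicalSpace V] [ChartedSpace (Fin n → ℂ) V] [Group V]
        [LieGroup 𝓘(ℂ, Fin n → ℂ) ω V] [MulDistribMulAction G V],
      (∀ g : G, ContMDiff 𝓘(ℂ, Fin n → ℂ) 𝓘(ℂ, Fin n → ℂ) ω (fun v : V => g • v)) →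
      (∃ x : OpenPartialHomeomorph V (Fin n → ℂ), IsLinearizingChart G x) ∧
      (∀ (x : OpenPartialHomeomorph V (Fin n → ℂ)) (hx : IsLinearizingChart G x),
        Function.Bijective
          (coinvariantMap G le_rfl (polyGerms x) (holGerms n V) (polyGerms_le_holGerms hx))) ∧
      Module.Finite ℂ (CoinvariantSpace G (holGerms n V)) ∧
      Module.finrank ℂ (CoinvariantSpace G (holGerms n V)) ≤ Nat.card G ^ n) ∧
    -- linear algebraic groups; `(𝒪_A)_e` is the stalk of the sheaf of regular functions
    (∀ (m : ℕ) (V : Subgroup (GL (Fin m) ℂ)) [MulDistribMulAction G V],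
      IsLinearAlgebraicGroup V →
      (∀ g : G, ∀ f ∈ regularFunctions V, (fun v => f (g • v)) ∈ regularFunctions V) →
      Function.Bijective
        (coinvariantMap G (nhds_le_zariskiNhds V) (regGerms V) (holGermsLinear V)
          (regGerms_le_holGermsLinear V)) ∧
      Module.Finite ℂ (CoinvariantSpace G (holGermsLinear V)) ∧
      ∃ d : ℕ, ringKrullDim (regularFunctions V) = d ∧
        Module.finrank ℂ (CoinvariantSpace G (holGermsLinear V)) ≤ Nat.card G ^ d) := by
  refine ⟨fun n V _ _ _ _ _ hG => ?_, fun m V _ hV hG =>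
    coinvariantMap_bijective_and_finrank_le_of_linear hV hG⟩
  have := Fintype.ofFinite G
  obtain ⟨x, hx⟩ := exists_isLinearizingChart_of_chart (G := G)
    (IsManifold.chart_mem_maximalAtlas (I := 𝓘(ℂ, Fin n → ℂ)) (n := ω) (1 : V))
    (mem_chart_source _ (1 : V)) hG
  exact ⟨⟨x, hx⟩, fun y hy => (hy.coinvariantMap_bijective_and_finrank_le hG).1,
    (hx.coinvariantMap_bijective_and_finrank_le hG).2⟩
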